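/- Let $V$ be a finite set of points in the Euclidean plane in general position: no three points of $V$ are collinear and no four points of $V$ are cocircular. Write $|ab|$ for the Euclidean distance, and $D(c;r)$ for the closed disk with centre $c$ and radius $r$, with boundary $\partial D(c;r)$ and interior $\mathrm{int}\,D(c;r)$. For a finite point set $N$, a pair $(v,y)$ of distinct points is an edge of the Delaunay triangulation of $N$ if there is a disk $D$ with $N\cap\partial D=\{v,y\}$ and $N\cap\mathrm{int}(D)=\emptyset$; three distinct points $u,v,w\in N$ form a triangular face $\Delta(u,v,w)$ if the interior of the disk with $u,v,w$ on its boundary contains no point of $N$. Two segments cross if they are not collinear and some point lies in the relative interior of both. For $v\in V$ let $N_v=\{u\in V: |uv|\le 1\}$ and let $\mathit{LDT}(v)$ be the Delaunay triangulation of $N_v$. The algorithm $\mathrm{PLDG}$ runs at every $v\in V$ as follows. (1) Let $E(v)$ be the set of edges of $\mathit{LDT}(v)$ incident on $v$. (2) Broadcast $v$ together with the circumcentres of all triangular faces $\Delta(u,v,w)$ of $\mathit{LDT}(v)$ with $\angle uvw>\pi/3$; the broadcast is received by the other points of $N_v$. (3) Process one after the other (in any order) all pairs $(x,c)$ such that the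 centre $c$ was received from the point $x$: if $\partial D(c;|cx|)$ contains exactly two points of $N_v$, let $p$ be the one different from $x$, let $\mathit{arc}=\partial D(c;|cx|)\setminus D(v;1)$, and choose an arbitrary point $z'\in\mathit{arc}$ with $|xz'|\le 1$ or $|pz'|\le 1$. For each edge $(v,y)$ currently in $E(v)$, choose an arbitrary disk $\mathit{Del}_v(v,y)$ with $N_v\cap\partial \mathit{Del}_v(v,y)=\{v,y\}$ and $N_v\cap\mathrm{int}(\mathit{Del}_v(v,y))=\emptyset$, and remove $(v,y)$ from $E(v)$ if $\mathit{arc}\subseteq\mathrm{int}(\mathit{Del}_v(v,y))$ and the segment $vy$ crosses at least one of the segments $xz'$ and $pz'$. Let $\mathit{PLDG}(V)$ be the graph with vertex set $V$ and edge set $\bigcup_{v\in V}E(v)$, where $E(v)$ denotes the final edge set computed at $v$. Then, whatever choices the algorithm makes, $\mathit{PLDG}(V)$ is plane: no two of its edges, drawn as straight-line segments, cross. -/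

import Mathlib

/-- The Euclidean plane. -/
abbrev Plane := EuclideanSpace ℝ (Fin 2)

namespace PLDG

/-- The straight-line segments `ab` and `cd` cross: they are not collinear and some point lies in
the relative interior of both. -/
def Cross (a b c d : Plane) : Prop :=
  ¬ Collinear ℝ ({a, b, c, d} : Set Plane) ∧
    (openSegment ℝ a b ∩ openSegment ℝ c d).Nonempty

/-- No three points of `V` are collinear and no four points of `V` are cocircular. -/
def GeneralPosition (V : Finset Plane) : Prop :=
  (∀ a ∈ V, ∀ b ∈ V, ∀ c ∈ V, a ≠ b → a ≠ c → b ≠ c →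
    ¬ Collinear ℝ ({a, b, c} : Set Plane)) ∧
  (∀ a ∈ V, ∀ b ∈ V, ∀ c ∈ V, ∀ d ∈ V,
    a ≠ b → a ≠ c → a ≠ d → b ≠ c → b ≠ d → c ≠ d →
    ¬ EuclideanGeometry.Cospherical ({a, b, c, d} : Set Plane))

/-- `N_v`: the points of `V` at distance at most one from `v`. -/
def nbhd (V : Finset Plane) (v : Plane) : Set Plane :=
  {u | u ∈ V ∧ dist u v ≤ 1}

/-- The disk with centre `c` and radius `r` certifies the Delaunay edge `(v, y)` of `N`: its
boundary meets `N` exactly in `v` and `y`, and its interior contains no point of `N`. -/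
def IsDel (N : Set Plane) (v y c : Plane) (r : ℝ) : Prop :=
  N ∩ Metric.sphere c r = {v, y} ∧ N ∩ Metric.ball c r = ∅

/-- `(v, y)` is an edge of the Delaunay triangulation of `N`. -/
def DelaunayEdge (N : Set Plane) (v y : Plane) : Prop :=
  v ≠ y ∧ ∃ (c : Plane) (r : ℝ), IsDel N v y c r

/-- `u, v, w` determine a triangular face of the Delaunay triangulation of `N`, and `c` is the
centre of the disk with these three points on its boundary. -/
def IsDelaunayFace (N : Set Plane) (u v w c : Plane) : Prop :=
  u ∈ N ∧ v ∈ N ∧ w ∈ N ∧ u ≠ v ∧ v ≠ w ∧ u ≠ w ∧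
    ∃ r : ℝ, u ∈ Metric.sphere c r ∧ v ∈ Metric.sphere c r ∧ w ∈ Metric.sphere c r ∧
      N ∩ Metric.ball c r = ∅

/-- The centres broadcast by `v`: the circumcentres of the triangular faces `Δ(u, v, w)` of the
Delaunay triangulation of `N_v` whose angle at `v` is larger than `π / 3`. -/
def broadcast (V : Finset Plane) (v : Plane) : Set Plane :=
  {c | ∃ u w : Plane, IsDelaunayFace (nbhd V v) u v w c ∧
    Real.pi / 3 < EuclideanGeometry.angle u v w}

/-- The pairs `(x, c)` such that `v` receives the centre `c` from the point `x`. -/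
def received (V : Finset Plane) (v : Plane) : Set (Plane × Plane) :=
  {m | m.1 ∈ nbhd V v ∧ m.1 ≠ v ∧ m.2 ∈ broadcast V m.1}

/-- The part of the circle with centre `c` through `x` that lies outside the closed unit disk
centred at `v`. -/
def arc (v x c : Plane) : Set Plane :=
  Metric.sphere c (dist c x) \ Metric.closedBall v 1

/-- `Step N v x c E E'`: the point `v`, with `N = N_v` and with current edge set `E`, may end up
with the edge set `E'` after it has processed the centre `c` received from `x`. An edge set of
edges incident on `v` is represented by the set of their other endpoints. The point `z` and the
disks `Del_v(v, y)` (centre `o y`, radius `r y`) are arbitrary admissible choices. -/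
inductive Step (N : Set Plane) (v x c : Plane) : Set Plane → Set Plane → Prop
  | skip (E : Set Plane)
      (h : (N ∩ Metric.sphere c (dist c x)).encard ≠ 2) :
      Step N v x c E E
  | check (E : Set Plane) (p z : Plane) (o : Plane → Plane) (r : Plane → ℝ)
      (h : (N ∩ Metric.sphere c (dist c x)).encard = 2)
      (hp : p ∈ (N \ {x}) ∩ Metric.sphere c (dist c x))
      (hz : z ∈ arc v x c)
      (hzd : dist x z ≤ 1 ∨ dist p z ≤ 1)
      (hdel : ∀ y ∈ E, IsDel N v y (o y) (r y)) :
      Step N v x c E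
        {y | y ∈ E ∧
          ¬ (arc v x c ⊆ Metric.ball (o y) (r y) ∧ (Cross v y x z ∨ Cross v y p z))}

/-- `Steps N v l E E'`: processing the received centres in the list `l` one after the other may
transform the edge set `E` into `E'`. -/
inductive Steps (N : Set Plane) (v : Plane) :
    List (Plane × Plane) → Set Plane → Set Plane → Prop
  | nil (E : Set Plane) : Steps N v [] E E
  | cons (x c : Plane) (l : List (Plane × Plane)) (E E' E'' : Set Plane)
      (h : Step N v x c E E') (hs : Steps N v l E' E'') :
      Steps N v ((x, c) :: l) E E''

/-- `E` is a possible edge set `E(v)` computed by the algorithm at `v`: start with the edges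
incident on `v` in the Delaunay triangulation of `N_v` and process every received centre once, in
some order. -/
def IsOutput (V : Finset Plane) (v : Plane) (E : Set Plane) : Prop :=
  ∃ l : List (Plane × Plane), l.Nodup ∧ (∀ m, m ∈ l ↔ m ∈ received V v) ∧
    Steps (nbhd V v) v l {y | DelaunayEdge (nbhd V v) v y} E

/-- `G` is a plane localized Delaunay graph of `V`: its vertex set is `V` and its edge set is the
union of edge sets `E(v)` computed by the points `v` of `V`. -/
def IsPLDG (V : Finset Plane) (G : SimpleGraph {v : Plane // v ∈ V}) : Prop :=
  ∃ E : {v : Plane // v ∈ V} → Set Plane, (∀ v, IsOutput V v.1 (E v)) ∧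
    ∀ a b, G.Adj a b ↔ b.1 ∈ E a ∨ a.1 ∈ E b

/-- The geometric graph `G` is plane: no two of its edges, drawn as straight-line segments,
cross. -/
def IsPlane {V : Finset Plane} (G : SimpleGraph {v : Plane // v ∈ V}) : Prop :=
  ∀ a b c d, G.Adj a b → G.Adj c d → ¬ Cross a.1 b.1 c.1 d.1

end PLDG

namespace PLDG

/-! Call a point visible from `v` if it is within distance one. Two geometric tools carry the proof.
The difference of the powers of a point with respect to two circles is affine, so circles can be
compared along segments (`power_le_on_cap`, `power_le_of_pt_eq_pt`). In a triangle whose sides at a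
vertex are at most 1 and whose third side is longer, the angle at that vertex exceeds π/3, so that
vertex broadcasts the circumcentre if the triangle is a face there.

The removal rule then works for every choice of `z'` and of the disks: if `x` and `p` are visible
from `v`, `z` is not, and `x` broadcasts the face `pxz`, an edge `vy` with `y` visible from `x` that
crosses `xz` or `pz` is removed (`arc_removal`, `Kept.not_removed`). Consequently an edge kept by
`v` is also Delaunay as seen from `y` (`Kept.weakDel_right`): otherwise a face at `y` would have a
side crossed by `vy` with exactly one end visible from `v`.

Suppose two kept edges cross. Some endpoint `x` of one sees both ends of the other, say `vy`
(`Cross.exists_hub`), and its edge `xw` is Delaunay as seen from `x`. Push the empty disk of `xw`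
towards `v` until it meets a point `t` (`Kept.obstructs_step`). Either `xt` crosses `vy` nearer to
`v`, or `t` lies in the triangle `xvy` and has an obstructing edge of its own, or the removal rule
applies. Minimality of the distance of `x` to the line `vy`, then of the crossing's distance to `v`,
excludes the first two outcomes (`Kept.not_obstructs`). -/

/-! ### Signed areas, powers of points and crossing segments -/

/-- Twice the signed area of the triangle `abc`. -/
def orient (a b c : Plane) : ℝ :=
  (b 0 - a 0) * (c 1 - a 1) - (b 1 - a 1) * (c 0 - a 0)

/-- The inner product of `b - a` and `c - a`. -/
def dotAt (a b c : Plane) : ℝ :=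
  (b 0 - a 0) * (c 0 - a 0) + (b 1 - a 1) * (c 1 - a 1)

/-- The power of the point `p` with respect to the circle with centre `c` and radius `r`. -/
noncomputable def power (c : Plane) (r : ℝ) (p : Plane) : ℝ := dist p c ^ 2 - r ^ 2

/-- Some disk with `a` and `b` on its boundary has no point of `N` in its interior. -/
def WeakDel (N : Set Plane) (a b : Plane) : Prop :=
  ∃ c : Plane, dist b c = dist a c ∧ ∀ q ∈ N, dist a c ≤ dist q c

theorem WeakDel.symm {N : Set Plane} {a b : Plane} (h : WeakDel N a b) : WeakDel N b a := by
  obtain ⟨c, h, hq⟩ := h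
  exact ⟨c, h.symm, fun q hqN => h ▸ hq q hqN⟩

/-- The point at parameter `t` on the line `ab`. -/
noncomputable def pt (a b : Plane) (t : ℝ) : Plane := (1 - t) • a + t • b

@[simp] theorem pt_apply (a b : Plane) (t : ℝ) (i : Fin 2) :
    pt a b t i = (1 - t) * a i + t * b i := by
  simp [pt]

theorem plane_ext {a b : Plane} (h0 : a 0 = b 0) (h1 : a 1 = b 1) : a = b := by
  ext i
  fin_cases i
  · exact h0
  · exact h1

theorem dist_sq (a b : Plane) : dist a b ^ 2 = (a 0 - b 0) ^ 2 + (a 1 - b 1) ^ 2 := by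
  rw [EuclideanSpace.dist_eq, Real.sq_sqrt (by positivity)]
  simp [Fin.sum_univ_two, Real.dist_eq, sq_abs]

/-- The quadratic term does not depend on the circle, so the difference of two powers is affine
along a line. All comparisons of circles rest on this. -/
theorem power_pt (c : Plane) (r : ℝ) (a b : Plane) (t : ℝ) :
    power c r (pt a b t) =
      (1 - t) * power c r a + t * power c r b - t * (1 - t) * dist a b ^ 2 := by
  simp only [power, dist_sq, pt_apply]
  ring

theorem orient_pt (a b p q : Plane) (t : ℝ) :
    orient a b (pt p q t) = (1 - t) * orient a b p + t * orient a b q := by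
  simp only [orient, pt_apply]
  ring

theorem orient_self_pt (a b : Plane) (t : ℝ) : orient a b (pt a b t) = 0 := by
  simp only [orient, pt_apply]
  ring

theorem dist_sq_pos {a b : Plane} (h : a ≠ b) : 0 < dist a b ^ 2 := by
  have := dist_pos.2 h
  positivity

theorem exists_pt_of_orient_eq_zero {a b p : Plane} (hab : a ≠ b) (h : orient a b p = 0) :
    ∃ t, p = pt a b t := by
  have hd := dist_sq_pos hab
  have hd' : dist a b ^ 2 ≠ 0 := hd.ne'
  refine ⟨dotAt a b p / dist a b ^ 2, ?_⟩
  rw [dist_sq] at *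
  unfold orient at h
  apply plane_ext <;> simp only [pt_apply, dotAt] <;> field_simp
  · linear_combination (-(b 1 - a 1)) * h
  · linear_combination (b 0 - a 0) * h

theorem collinear_of_orient_eq_zero {a b c d : Plane} (hab : a ≠ b) (hc : orient a b c = 0)
    (hd : orient a b d = 0) : Collinear ℝ ({a, b, c, d} : Set Plane) := by
  obtain ⟨s, hs⟩ := exists_pt_of_orient_eq_zero hab hc
  obtain ⟨t, ht⟩ := exists_pt_of_orient_eq_zero hab hd
  rw [collinear_iff_of_mem (p₀ := a) (by simp)]
  refine ⟨b - a, ?_⟩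
  have key : ∀ u : ℝ, pt a b u = u • (b - a) +ᵥ a := by
    intro u
    apply plane_ext <;> simp <;> ring
  intro p hp
  simp only [Set.mem_insert_iff, Set.mem_singleton_iff] at hp
  rcases hp with rfl | rfl | rfl | rfl
  · exact ⟨0, by simp⟩
  · exact ⟨1, by simp⟩
  · exact ⟨s, by rw [hs]; exact key s⟩
  · exact ⟨t, by rw [ht]; exact key t⟩

theorem orient_eq_zero_of_collinear {a b c : Plane}
    (h : Collinear ℝ ({a, b, c} : Set Plane)) : orient a b c = 0 := by
  rw [collinear_iff_of_mem (p₀ := a) (by simp)] at h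
  obtain ⟨u, hu⟩ := h
  obtain ⟨s, hs⟩ := hu b (by simp)
  obtain ⟨t, ht⟩ := hu c (by simp)
  rw [hs, ht]
  simp [orient]
  ring

theorem GeneralPosition.orient_ne_zero {V : Finset Plane} (hV : GeneralPosition V) {a b c : Plane}
    (ha : a ∈ V) (hb : b ∈ V) (hc : c ∈ V) (hab : a ≠ b) (hac : a ≠ c) (hbc : b ≠ c) :
    orient a b c ≠ 0 := by
  intro h
  have := collinear_of_orient_eq_zero hab h h
  simp only [Set.insert_eq_of_mem (Set.mem_singleton c)] at this
  exact hV.1 a ha b hb c hc hab hac hbc this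

theorem mem_openSegment_iff_pt {a b p : Plane} :
    p ∈ openSegment ℝ a b ↔ ∃ t, 0 < t ∧ t < 1 ∧ p = pt a b t := by
  constructor
  · rintro ⟨s, t, hs, ht, hst, rfl⟩
    exact ⟨t, ht, by linarith, by rw [pt, ← hst]; simp⟩
  · rintro ⟨t, h0, h1, rfl⟩
    exact ⟨1 - t, t, by linarith, h0, by ring, rfl⟩

theorem cross_iff {a b c d : Plane} (hab : a ≠ b) :
    Cross a b c d ↔ orient a b c * orient a b d < 0 ∧
      ∃ s t, 0 < s ∧ s < 1 ∧ 0 < t ∧ t < 1 ∧ pt a b s = pt c d t := by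
  constructor
  · rintro ⟨hcol, p, hp, hq⟩
    obtain ⟨s, hs0, hs1, rfl⟩ := mem_openSegment_iff_pt.1 hp
    obtain ⟨t, ht0, ht1, ht⟩ := mem_openSegment_iff_pt.1 hq
    refine ⟨?_, s, t, hs0, hs1, ht0, ht1, ht⟩
    have h0 := orient_self_pt a b s
    rw [ht, orient_pt] at h0
    by_contra hneg
    apply hcol
    have hc : orient a b c = 0 := by
      have : (1 - t) * orient a b c ^ 2 + t * (orient a b c * orient a b d) = 0 := by
        linear_combination orient a b c * h0
      have h1 : 0 ≤ t * (orient a b c * orient a b d) := mul_nonneg ht0.le (not_lt.1 hneg)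
      have h2 : 0 ≤ (1 - t) * orient a b c ^ 2 := mul_nonneg (by linarith) (sq_nonneg _)
      have h3 : (1 - t) * orient a b c ^ 2 = 0 := by linarith
      rcases mul_eq_zero.1 h3 with h | h
      · linarith
      · exact pow_eq_zero_iff (two_ne_zero) |>.1 h
    have hd : orient a b d = 0 := by
      rw [hc] at h0
      have : t * orient a b d = 0 := by linarith
      exact (mul_eq_zero.1 this).resolve_left ht0.ne'
    exact collinear_of_orient_eq_zero hab hc hd
  · rintro ⟨hneg, s, t, hs0, hs1, ht0, ht1, h⟩
    refine ⟨fun hcol => ?_, pt a b s, mem_openSegment_iff_pt.2 ⟨s, hs0, hs1, rfl⟩,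
      mem_openSegment_iff_pt.2 ⟨t, ht0, ht1, h⟩⟩
    have : orient a b c = 0 := orient_eq_zero_of_collinear (hcol.subset (by
      intro p hp
      simp only [Set.mem_insert_iff, Set.mem_singleton_iff] at hp ⊢
      tauto))
    rw [this] at hneg
    simp at hneg

theorem Cross.swap {a b c d : Plane} (h : Cross a b c d) : Cross c d a b := by
  obtain ⟨h1, h2⟩ := h
  refine ⟨?_, by rwa [Set.inter_comm]⟩
  have : ({c, d, a, b} : Set Plane) = {a, b, c, d} := by
    ext p
    simp only [Set.mem_insert_iff, Set.mem_singleton_iff]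
    tauto
  rwa [this]

theorem Cross.symm_right {a b c d : Plane} (h : Cross a b c d) : Cross a b d c := by
  obtain ⟨h1, h2⟩ := h
  refine ⟨?_, by rwa [openSegment_symm ℝ d c]⟩
  rwa [Set.pair_comm d c]

theorem Cross.symm_left {a b c d : Plane} (h : Cross a b c d) : Cross b a c d :=
  h.swap.symm_right.swap

/-! ### Comparing circles along segments -/

/-- A line point that lies in a disk containing a point of the segment `vy` but neither endpoint in
its interior lies on the segment. -/
theorem param_mem_of_power {c v y : Plane} {r s u : ℝ} (hv : 0 ≤ power c r v)
    (hy : 0 ≤ power c r y) (hs0 : 0 < s) (hs1 : s < 1) (hs : power c r (pt v y s) < 0)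
    (hu : power c r (pt v y u) ≤ 0) : 0 ≤ u ∧ u ≤ 1 := by
  -- Along the line the power is a convex quadratic, nonnegative at 0 and 1 and negative in between,
  -- hence positive outside [0, 1].
  rw [power_pt] at hs hu
  set A := power c r v
  set B := power c r y
  set K := dist v y ^ 2
  have hK : 0 ≤ K := sq_nonneg _
  have h1 : B < (1 - s) * K := by
    have : s * B < s * ((1 - s) * K) := by nlinarith [mul_nonneg (sub_pos.2 hs1).le hv]
    exact lt_of_mul_lt_mul_left this hs0.le
  have h2 : A < s * K := by
    have : (1 - s) * A < (1 - s) * (s * K) := by nlinarith [mul_nonneg hs0.le hy]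
    exact lt_of_mul_lt_mul_left this (by linarith)
  constructor
  · by_contra hneg
    push Not at hneg
    have h3 : 0 < (1 - u) * K - B := by nlinarith
    nlinarith [mul_pos (neg_pos.2 hneg) h3, mul_nonneg (by linarith : 0 ≤ 1 - u) hv]
  · by_contra hneg
    push Not at hneg
    have h3 : 0 < u * K - A := by nlinarith
    nlinarith [mul_pos (sub_pos.2 hneg) h3, mul_nonneg (by linarith : 0 ≤ u) hy]

theorem param_mem_of_power_lt {c v y : Plane} {r s u : ℝ} (hv : 0 ≤ power c r v)
    (hy : 0 ≤ power c r y) (hs0 : 0 < s) (hs1 : s < 1) (hs : power c r (pt v y s) < 0)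
    (hu : power c r (pt v y u) < 0) : 0 < u ∧ u < 1 := by
  obtain ⟨h0, h1⟩ := param_mem_of_power hv hy hs0 hs1 hs hu.le
  refine ⟨h0.lt_of_ne ?_, h1.lt_of_ne ?_⟩
  · rintro rfl
    simp [pt] at hu
    linarith
  · rintro rfl
    simp [pt] at hu
    linarith

theorem exists_pt_eq_pt {v y e q : Plane} (hvy : v ≠ y) (he : orient v y e ≠ 0)
    (heq : orient v y e * orient v y q ≤ 0) :
    ∃ s u, 0 < s ∧ s ≤ 1 ∧ (orient v y q ≠ 0 → s < 1) ∧ pt e q s = pt v y u := by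
  set E := orient v y e
  set Q := orient v y q
  have hE : 0 < E ^ 2 := by positivity
  have hne : E - Q ≠ 0 := by
    intro h
    have : E = Q := by linarith
    rw [← this] at heq
    nlinarith
  have hpos : 0 < E * (E - Q) := by nlinarith
  have hs : E / (E - Q) = E * (E - Q) / (E - Q) ^ 2 := by field_simp
  have hs1 : 1 - E / (E - Q) = -(E * Q) / (E * (E - Q)) := by
    field_simp
    ring
  obtain ⟨u, hu⟩ := exists_pt_of_orient_eq_zero (p := pt e q (E / (E - Q))) hvy (by
    rw [orient_pt]
    change (1 - E / (E - Q)) * E + E / (E - Q) * Q = 0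
    field_simp
    ring)
  refine ⟨E / (E - Q), u, ?_, ?_, ?_, hu⟩
  · rw [hs]
    positivity
  · have : 0 ≤ 1 - E / (E - Q) := by
      rw [hs1]
      exact div_nonneg (by linarith) hpos.le
    linarith
  · intro hQ
    have h0 : E * Q ≠ 0 := mul_ne_zero he hQ
    have : 0 < 1 - E / (E - Q) := by
      rw [hs1]
      exact div_pos (by linarith [lt_of_le_of_ne heq h0]) hpos
    linarith

/-- Two points of a disk on different sides of the line `vy` span a segment crossing `vy`, if the
disk meets `vy` but contains neither endpoint in its interior. -/
theorem cross_of_power {c v y e q : Plane} {r s : ℝ} (hvy : v ≠ y) (hv : 0 ≤ power c r v)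
    (hy : 0 ≤ power c r y) (hs0 : 0 < s) (hs1 : s < 1) (hs : power c r (pt v y s) < 0)
    (he : power c r e ≤ 0) (hq : power c r q ≤ 0)
    (hside : orient v y e * orient v y q < 0) : Cross v y e q := by
  have he0 : orient v y e ≠ 0 := by
    intro h
    simp [h] at hside
  have hq0 : orient v y q ≠ 0 := by
    intro h
    simp [h] at hside
  have heq : e ≠ q := by
    rintro rfl
    nlinarith [mul_self_nonneg (orient v y e)]
  obtain ⟨t, u, ht0, -, ht1, htu⟩ := exists_pt_eq_pt hvy he0 hside.le
  replace ht1 := ht1 hq0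
  have hneg : power c r (pt v y u) < 0 := by
    rw [← htu, power_pt]
    have h1 := mul_pos (mul_pos ht0 (sub_pos.2 ht1)) (dist_sq_pos heq)
    nlinarith
  obtain ⟨hu0, hu1⟩ := param_mem_of_power_lt hv hy hs0 hs1 hs hneg
  exact (cross_iff hvy).2 ⟨hside, u, t, hu0, hu1, ht0, ht1, htu.symm⟩

/-- Comparison of two circles on a cap of the first one. -/
theorem power_le_on_cap {c c' v y w q : Plane} {r r' s : ℝ} (hvy : v ≠ y) (hv : 0 ≤ power c r v)
    (hy : 0 ≤ power c r y) (hs0 : 0 < s) (hs1 : s < 1) (hs : power c r (pt v y s) < 0)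
    (hw : power c r w ≤ 0) (hq : power c r q ≤ 0)
    (hw0 : orient v y w ≠ 0) (hside : orient v y w * orient v y q ≤ 0)
    (hv' : power c' r' v ≤ power c r v) (hy' : power c' r' y ≤ power c r y)
    (hw' : power c r w < power c' r' w) : power c' r' q ≤ power c r q := by
  by_contra hneg
  push Not at hneg
  -- The segment `wq` meets the line `vy` inside the first disk, hence on the segment `vy`. There
  -- the affine difference of powers has the sign it has at `v` and `y`, opposite to that at `w`.
  obtain ⟨t, u, ht0, ht1, -, htu⟩ := exists_pt_eq_pt hvy hw0 hside
  have h1 : power c r (pt v y u) ≤ 0 := by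
    rw [← htu, power_pt]
    have h1 := mul_nonneg (mul_nonneg ht0.le (sub_nonneg.2 ht1)) (sq_nonneg (dist w q))
    nlinarith
  obtain ⟨hu0, hu1⟩ := param_mem_of_power hv hy hs0 hs1 hs h1
  have h2 : power c' r' (pt v y u) ≤ power c r (pt v y u) := by
    rw [power_pt, power_pt]
    nlinarith
  have h3 : power c r (pt w q t) < power c' r' (pt w q t) := by
    rw [power_pt, power_pt]
    have h4 := mul_nonneg (sub_nonneg.2 ht1) (sub_pos.2 hw').le
    have h5 := mul_pos ht0 (sub_pos.2 hneg)
    nlinarith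
  rw [htu] at h3
  linarith

/-! ### Angles larger than π/3 -/

theorem pi_div_three_lt_angle {x p z : Plane} (h : 2 * dotAt x p z < dist p x * dist z x) :
    Real.pi / 3 < EuclideanGeometry.angle p x z := by
  by_contra hneg
  push Not at hneg
  have h1 := InnerProductGeometry.cos_angle_mul_norm_mul_norm (p - x) (z - x)
  have h2 : Real.cos (Real.pi / 3) ≤ Real.cos (InnerProductGeometry.angle (p - x) (z - x)) :=
    Real.cos_le_cos_of_nonneg_of_le_pi (InnerProductGeometry.angle_nonneg _ _)
      (by linarith [Real.pi_pos]) hneg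
  rw [Real.cos_pi_div_three] at h2
  have h3 : inner ℝ (p - x) (z - x) = dotAt x p z := by
    simp [PiLp.inner_apply, Fin.sum_univ_two, dotAt]
    ring
  rw [h3, ← dist_eq_norm, ← dist_eq_norm] at h1
  have h4 : 0 ≤ dist p x * dist z x := by positivity
  nlinarith

/-- The two shorter sides of a triangle enclose an angle larger than `π / 3`. -/
theorem two_dotAt_lt {x a b : Plane} (ha : dist a x ≤ 1) (hb : dist b x ≤ 1)
    (hab : 1 < dist a b) : 2 * dotAt x a b < dist a x * dist b x := by
  -- Law of cosines; then `|ax|² + |bx|² - 1` is at most the square of the shorter side, hence at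
  -- most `|ax||bx|`.
  have h1 : dist a b ^ 2 = dist a x ^ 2 + dist b x ^ 2 - 2 * dotAt x a b := by
    simp only [dist_sq, dotAt]
    ring
  have h2 : 1 < dist a b ^ 2 := by nlinarith
  have h3 : 0 ≤ dist a x := dist_nonneg
  have h4 : 0 ≤ dist b x := dist_nonneg
  rcases le_total (dist a x) (dist b x) with h | h <;> nlinarith

/-- Widening an angle larger than `π / 3`. -/
theorem two_dotAt_lt_of_cone {x a b v : Plane} {l m : ℝ} (hl : 0 ≤ l) (hm : 0 ≤ m)
    (h0 : v 0 - x 0 = l * (a 0 - x 0) + m * (b 0 - x 0))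
    (h1 : v 1 - x 1 = l * (a 1 - x 1) + m * (b 1 - x 1))
    (hav : 2 * dotAt x a v < dist a x * dist v x) :
    2 * dotAt x a b < dist a x * dist b x := by
  by_contra hneg
  push Not at hneg
  -- Relative to `x`, if `|a||b| ≤ 2 a·b`, then `|a||v| ≤ l|a|² + m|a||b| ≤ 2l|a|² + 2m a·b = 2
  -- a·v`, against `hav`.
  have hvx : dist v x ≤ l * dist a x + m * dist b x := by
    have hv : v - x = l • (a - x) + m • (b - x) := plane_ext (by simpa using h0) (by simpa using h1)
    rw [dist_eq_norm, dist_eq_norm, dist_eq_norm, hv]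
    refine (norm_add_le _ _).trans ?_
    rw [norm_smul, norm_smul, Real.norm_of_nonneg hl, Real.norm_of_nonneg hm]
  have h2 : dotAt x a v = l * dist a x ^ 2 + m * dotAt x a b := by
    rw [dist_sq, dotAt, dotAt, h0, h1]
    ring
  have h3 : 0 ≤ dist a x := dist_nonneg
  have h4 := mul_le_mul_of_nonneg_left hneg hm
  have h5 := mul_le_mul_of_nonneg_left hvx h3
  nlinarith [mul_nonneg hl (sq_nonneg (dist a x))]

/-! ### Surviving edges and their disks -/

/-- `y` is in the edge set `E` that `v` computes only if it is in the initial one and no processed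
centre removes it. -/
theorem Steps.exists_step {N : Set Plane} {v : Plane} {l : List (Plane × Plane)}
    {E E' : Set Plane} (h : Steps N v l E E') {y : Plane} (hy : y ∈ E') :
    y ∈ E ∧ ∀ m ∈ l, ∃ E₁ E₂, Step N v m.1 m.2 E₁ E₂ ∧ y ∈ E₁ ∧ y ∈ E₂ := by
  induction h with
  | nil E => exact ⟨hy, by simp⟩
  | cons x c l E E' E'' h hs ih =>
    obtain ⟨h1, h2⟩ := ih hy
    have h3 : y ∈ E := by
      cases h with
      | skip _ => exact h1
      | check p z o r _ _ _ _ _ => exact h1.1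
    refine ⟨h3, ?_⟩
    intro m hm
    rcases List.mem_cons.1 hm with rfl | hm
    · exact ⟨E, E', h, h3, h1⟩
    · exact h2 m hm

/-- `y` is in some possible edge set computed at `v`. -/
def Kept (V : Finset Plane) (v y : Plane) : Prop := ∃ E, IsOutput V v E ∧ y ∈ E

theorem Kept.delaunayEdge {V : Finset Plane} {v y : Plane} (h : Kept V v y) :
    DelaunayEdge (nbhd V v) v y := by
  obtain ⟨E, ⟨l, -, -, hs⟩, hy⟩ := h
  exact (hs.exists_step hy).1

theorem Kept.exists_step {V : Finset Plane} {v y x c : Plane} (h : Kept V v y)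
    (hr : (x, c) ∈ received V v) :
    ∃ E₁ E₂, Step (nbhd V v) v x c E₁ E₂ ∧ y ∈ E₁ ∧ y ∈ E₂ := by
  obtain ⟨E, ⟨l, -, hl, hs⟩, hy⟩ := h
  exact (hs.exists_step hy).2 (x, c) ((hl _).2 hr)

theorem IsDel.radius_nonneg {N : Set Plane} {v y c : Plane} {r : ℝ} (h : IsDel N v y c r) :
    0 ≤ r := by
  have h1 : v ∈ N ∩ Metric.sphere c r := by rw [h.1]; simp
  rw [← Metric.mem_sphere.1 h1.2]
  exact dist_nonneg

theorem IsDel.power_left {N : Set Plane} {v y c : Plane} {r : ℝ} (h : IsDel N v y c r) :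
    v ∈ N ∧ power c r v = 0 := by
  have h1 : v ∈ N ∩ Metric.sphere c r := by rw [h.1]; simp
  exact ⟨h1.1, by rw [power, Metric.mem_sphere.1 h1.2, sub_self]⟩

theorem IsDel.power_right {N : Set Plane} {v y c : Plane} {r : ℝ} (h : IsDel N v y c r) :
    y ∈ N ∧ power c r y = 0 := by
  have h1 : y ∈ N ∩ Metric.sphere c r := by rw [h.1]; simp
  exact ⟨h1.1, by rw [power, Metric.mem_sphere.1 h1.2, sub_self]⟩

theorem IsDel.power_pos {N : Set Plane} {v y c q : Plane} {r : ℝ} (h : IsDel N v y c r)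
    (hq : q ∈ N) (hqv : q ≠ v) (hqy : q ≠ y) : 0 < power c r q := by
  have h0 := h.radius_nonneg
  have h1 : q ∉ Metric.ball c r := fun hb => by
    have : q ∈ N ∩ Metric.ball c r := ⟨hq, hb⟩
    rw [h.2] at this
    exact this
  have h2 : q ∉ Metric.sphere c r := fun hb => by
    have : q ∈ N ∩ Metric.sphere c r := ⟨hq, hb⟩
    rw [h.1] at this
    rcases this with rfl | h
    · exact hqv rfl
    · exact hqy h
  rw [Metric.mem_ball, not_lt] at h1
  rw [Metric.mem_sphere] at h2
  have h3 : r < dist q c := lt_of_le_of_ne h1 (Ne.symm h2)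
  unfold power
  nlinarith

theorem power_one_nonpos {v q : Plane} (h : dist q v ≤ 1) : power v 1 q ≤ 0 := by
  have : 0 ≤ dist q v := dist_nonneg
  unfold power
  nlinarith

theorem power_one_pos {v q : Plane} (h : 1 < dist q v) : 0 < power v 1 q := by
  unfold power
  nlinarith

theorem dist_le_one_of_power {v q : Plane} (h : power v 1 q ≤ 0) : dist q v ≤ 1 := by
  by_contra hneg
  linarith [power_one_pos (not_le.1 hneg)]

theorem power_self_one (v : Plane) : power v 1 v = -1 := by simp [power]

theorem power_nonneg_of_le {c x q : Plane} (h : dist x c ≤ dist q c) :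
    0 ≤ power c (dist x c) q := by
  have : 0 ≤ dist x c := dist_nonneg
  unfold power
  nlinarith

theorem power_eq_zero_of_eq {c x q : Plane} (h : dist q c = dist x c) :
    power c (dist x c) q = 0 := by
  rw [power, h, sub_self]

/-! ### The removal step -/

/-- The geometric core of the removal step: a mixed triangle with one vertex `z` invisible from `v`
whose side `ez` crosses `vy`. -/
theorem arc_removal {N : Set Plane} {v y x e z z' c o : Plane} {r : ℝ} (hvy : v ≠ y)
    (hdel : IsDel N v y o r) (hv : dist x c ≤ dist v c) (hy : dist x c ≤ dist y c)
    (he : dist e c = dist x c) (hz : dist z c = dist x c) (hyv : dist y v ≤ 1)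
    (heN : e ∈ N) (hev : dist e v ≤ 1) (hzv : 1 < dist z v) (hcross : Cross v y e z)
    (hz' : z' ∈ arc v x c) : z' ∈ Metric.ball o r ∧ Cross v y e z' := by
  obtain ⟨hside, s, t, hs0, hs1, ht0, ht1, hst⟩ := (cross_iff hvy).1 hcross
  have he0 : orient v y e ≠ 0 := by
    intro h
    simp [h] at hside
  have hez : e ≠ z := by
    rintro rfl
    linarith
  have hkv := power_nonneg_of_le hv
  have hky := power_nonneg_of_le hy
  have hke := power_eq_zero_of_eq he
  have hkz := power_eq_zero_of_eq hz
  have hks : power c (dist x c) (pt v y s) < 0 := by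
    rw [hst, power_pt, hke, hkz]
    have := mul_pos (mul_pos ht0 (sub_pos.2 ht1)) (dist_sq_pos hez)
    linarith
  have hz'c : dist z' c = dist x c := by
    have := hz'.1
    rwa [Metric.mem_sphere, dist_comm c x] at this
  have hz'v : 1 < dist z' v := by simpa using hz'.2
  have hkz' := power_eq_zero_of_eq hz'c
  have hfv : power v 1 v ≤ power c (dist x c) v := by
    rw [power_self_one]
    linarith
  have hfy : power v 1 y ≤ power c (dist x c) y := (power_one_nonpos hyv).trans hky
  -- Comparison with the unit disk of `v`: as `z` is invisible, points of the circle beyond `vy`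
  -- from `z` are visible, so `z'` lies on the side of `z`.
  have hside' : orient v y e * orient v y z' < 0 := by
    by_contra hneg
    have hz0 : orient v y z ≠ 0 := by
      intro h
      simp [h] at hside
    have h1 : orient v y z * orient v y z' ≤ 0 := by
      have h2 : 0 ≤ (orient v y e * orient v y z') * -(orient v y e * orient v y z) :=
        mul_nonneg (not_lt.1 hneg) (by linarith)
      have h3 : 0 < orient v y e ^ 2 := by positivity
      have h4 : orient v y e ^ 2 * (orient v y z * orient v y z') ≤ 0 := by nlinarith
      exact nonpos_of_mul_nonpos_right h4 h3
    have := power_le_on_cap hvy hkv hky hs0 hs1 hks hkz.le hkz'.le hz0 h1 hfv hfy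
      (by rw [hkz]; exact power_one_pos hzv)
    linarith [power_one_pos hz'v]
  have hc := cross_of_power hvy hkv hky hs0 hs1 hks hke.le hkz'.le hside'
  refine ⟨?_, hc⟩
  obtain ⟨-, a, b, ha0, ha1, hb0, hb1, hab⟩ := (cross_iff hvy).1 hc
  have hne : e ≠ v ∧ e ≠ y := by
    constructor <;> rintro rfl <;> exact he0 (by simp [orient]; try ring)
  have hDe := hdel.power_pos heN hne.1 hne.2
  have hDv := hdel.power_left.2
  have hDy := hdel.power_right.2
  -- At the crossing of `vy` with `ez'` the Delaunay disk has the smaller power, at `e` the larger;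
  -- by affinity it has the smaller one at `z'`, where the other power is 0.
  have h1 : power o r (pt v y a) ≤ power c (dist x c) (pt v y a) := by
    rw [power_pt, power_pt, hDv, hDy]
    nlinarith
  rw [hab, power_pt, power_pt, hke, hkz'] at h1
  have h2 : power o r z' < 0 := by
    have h3 : b * power o r z' < 0 := by nlinarith
    nlinarith
  rw [Metric.mem_ball]
  have h0 := hdel.radius_nonneg
  unfold power at h2
  nlinarith [dist_nonneg (x := z') (y := o)]

/-- The point `x` broadcasts `c`, and `v` must process it. Whatever `z'` and disks `v` picks,
`arc_removal` makes the test succeed, so an edge crossing `xz` or `pz` could not have survived. -/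
theorem Kept.not_removed {V : Finset Plane} (hV : GeneralPosition V) {v y x p z c : Plane}
    (hk : Kept V v y) (hx : x ∈ V) (hp : p ∈ V) (hz : z ∈ V) (hxv : x ≠ v)
    (hpx : p ≠ x) (hzx : z ≠ x) (hdxv : dist x v ≤ 1) (hdpv : dist p v ≤ 1)
    (hdzv : 1 < dist z v) (hdpx : dist p x ≤ 1) (hdzx : dist z x ≤ 1) (hdyx : dist y x ≤ 1)
    (hpc : dist p c = dist x c) (hzc : dist z c = dist x c)
    (hempty : ∀ q ∈ nbhd V x, dist x c ≤ dist q c)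
    (hangle : 2 * dotAt x p z < dist p x * dist z x) :
    ¬ (Cross v y x z ∨ Cross v y p z) := by
  intro hcross
  have hdel := hk.delaunayEdge
  obtain ⟨hvy, c₀, r₀, hdel₀⟩ := hdel
  have hvN := hdel₀.power_left.1
  have hyN := hdel₀.power_right.1
  have hpz : p ≠ z := by
    rintro rfl
    linarith
  have hface : IsDelaunayFace (nbhd V x) p x z c := by
    refine ⟨⟨hp, hdpx⟩, ⟨hx, by simp⟩, ⟨hz, hdzx⟩, hpx, hzx.symm, hpz, dist x c, hpc, rfl, hzc, ?_⟩
    ext q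
    simp only [Set.mem_inter_iff, Metric.mem_ball, Set.mem_empty_iff_false, iff_false, not_and,
      not_lt]
    exact hempty q
  obtain ⟨E₁, E₂, hstep, hy₁, hy₂⟩ := hk.exists_step (x := x) (c := c)
    ⟨⟨hx, hdxv⟩, hxv, p, z, hface, pi_div_three_lt_angle hangle⟩
  -- The circle already carries `x`, `p` and the invisible `z`; a further point would be a fourth
  -- cocircular one.
  have hinter : nbhd V v ∩ Metric.sphere c (dist c x) = {x, p} := by
    ext q
    simp only [Set.mem_inter_iff, Metric.mem_sphere, Set.mem_insert_iff, Set.mem_singleton_iff]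
    constructor
    · rintro ⟨⟨hq, hqv⟩, hqc⟩
      by_contra hne
      push Not at hne
      have hqz : q ≠ z := by
        rintro rfl
        linarith
      refine hV.2 x hx p hp z hz q hq hpx.symm hzx.symm hne.1.symm hpz hne.2.symm hqz.symm
        ⟨c, dist x c, ?_⟩
      rintro a (rfl | rfl | rfl | rfl)
      · rfl
      · exact hpc
      · exact hzc
      · rw [hqc, dist_comm]
    · rintro (rfl | rfl)
      · exact ⟨⟨hx, hdxv⟩, dist_comm _ _⟩
      · exact ⟨⟨hp, hdpv⟩, by rw [hpc, dist_comm]⟩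
  have hxN : x ∈ nbhd V v := ⟨hx, hdxv⟩
  have hpN : p ∈ nbhd V v := ⟨hp, hdpv⟩
  have hvc := hempty v ⟨hvN.1, by rwa [dist_comm]⟩
  have hyc := hempty y ⟨hyN.1, hdyx⟩
  cases hstep with
  | skip h => exact h (by rw [hinter, Set.encard_pair hpx.symm])
  | check p' z' o r h hp' hz' hzd hdel' =>
    have hpp : p' = p := by
      have h1 : p' ∈ nbhd V v ∩ Metric.sphere c (dist c x) := ⟨hp'.1.1, hp'.2⟩
      rw [hinter] at h1
      rcases h1 with h1 | h1
      · exact absurd h1 hp'.1.2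
      · exact h1
    subst hpp
    apply hy₂.2
    have key : ∀ e ∈ nbhd V v, dist e c = dist x c → Cross v y e z → ∀ z' ∈ arc v x c,
        z' ∈ Metric.ball (o y) (r y) ∧ Cross v y e z' := fun e he hec hcr z' hz' =>
      arc_removal hvy (hdel' y hy₁) hvc hyc hec hzc hyN.2 he he.2 hdzv hcr hz'
    rcases hcross with hcr | hcr
    · have := key x hxN rfl hcr
      exact ⟨fun q hq => (this q hq).1, Or.inl (this _ hz').2⟩
    · have := key p' hpN hpc hcr
      exact ⟨fun q hq => (this q hq).1, Or.inr (this _ hz').2⟩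

/-! ### Delaunay edges and faces at a point -/

theorem dist_eq_iff_dotAt {y q c : Plane} :
    dist q c = dist y c ↔ 2 * dotAt y q c = dotAt y q q := by
  rw [← sq_eq_sq₀ dist_nonneg dist_nonneg, dist_sq, dist_sq, dotAt, dotAt]
  constructor <;> intro h <;> linarith

theorem dist_le_iff_dotAt {y q c : Plane} :
    dist y c ≤ dist q c ↔ 2 * dotAt y q c ≤ dotAt y q q := by
  rw [← sq_le_sq₀ dist_nonneg dist_nonneg, dist_sq, dist_sq, dotAt, dotAt]
  constructor <;> intro h <;> linarith

theorem dotAt_self_nonneg (y q : Plane) : 0 ≤ dotAt y q q :=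
  add_nonneg (mul_self_nonneg _) (mul_self_nonneg _)

/-- Cramer's rule for the two linear equations of `dist_eq_iff_dotAt`. -/
theorem exists_circumcentre {y s t : Plane} (h : orient y s t ≠ 0) :
    ∃ c, dist s c = dist y c ∧ dist t c = dist y c := by
  refine ⟨!₂[y 0 + ((t 1 - y 1) * dotAt y s s - (s 1 - y 1) * dotAt y t t) / (2 * orient y s t),
    y 1 + ((s 0 - y 0) * dotAt y t t - (t 0 - y 0) * dotAt y s s) / (2 * orient y s t)], ?_, ?_⟩
  · rw [dist_eq_iff_dotAt]
    conv_lhs => rw [dotAt]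
    simp only [Matrix.cons_val_zero, Matrix.cons_val_one, add_sub_cancel_left]
    field_simp
    unfold orient
    ring
  · rw [dist_eq_iff_dotAt]
    conv_lhs => rw [dotAt]
    simp only [Matrix.cons_val_zero, Matrix.cons_val_one, add_sub_cancel_left]
    field_simp
    unfold orient
    ring

theorem cone_dotAt (y v s t c : Plane) :
    orient y v s * dotAt y t c - orient y v t * dotAt y s c =
      -(orient y s t) * dotAt y v c := by
  unfold orient dotAt
  ring

/-- If no two points of `N` on opposite sides of `yv` obstruct it, `yv` is a Delaunay edge. -/
theorem weakDel_of_forall {N : Set Plane} (hN : N.Finite) {y v : Plane}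
    (hcol : ∀ q ∈ N, orient y v q = 0 → q = y ∨ q = v)
    (h : ∀ s ∈ N, ∀ t ∈ N, 0 < orient y v s → orient y v t < 0 → orient y s t < 0 →
      -(orient y s t) * dotAt y v v ≤
        orient y v s * dotAt y t t - orient y v t * dotAt y s s) :
    WeakDel N y v := by
  -- The circles through `y` and `v` have centre at the midpoint plus `τ` times the normal.
  -- Emptiness requires `τ ≤ φ q` for `q` on the positive side of `yv` and `φ q ≤ τ` on the negative
  -- side, so a valid `τ` exists once each lower bound is below each upper one.
  set φ : Plane → ℝ := fun q => (dotAt y q q - dotAt y q v) / (2 * orient y v q) with hφ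
  have hmul : ∀ q, orient y v q ≠ 0 →
      2 * (φ q * orient y v q) = dotAt y q q - dotAt y q v := by
    intro q hq
    simp only [hφ]
    field_simp
  have key : ∀ s ∈ N, ∀ t ∈ N, 0 < orient y v s → orient y v t < 0 → φ t ≤ φ s := by
    intro s hs t ht hos hot
    by_contra hneg
    push Not at hneg
    have h1 := hmul s hos.ne'
    have h2 := hmul t hot.ne
    have h3 := cone_dotAt y v s t v
    have h4 : 0 < (φ t - φ s) * (orient y v s * -orient y v t) :=
      mul_pos (by linarith) (mul_pos hos (by linarith))
    have h5 : orient y v s * dotAt y t t - orient y v t * dotAt y s s <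
        -(orient y s t) * dotAt y v v := by
      have e1 : orient y v s * (2 * (φ t * orient y v t)) =
        orient y v s * (dotAt y t t - dotAt y t v) := by rw [h2]
      have e2 : orient y v t * (2 * (φ s * orient y v s)) =
        orient y v t * (dotAt y s s - dotAt y s v) := by rw [h1]
      linarith
    have h6 : 0 ≤ orient y v s * dotAt y t t := mul_nonneg hos.le (dotAt_self_nonneg _ _)
    have h7 : 0 ≤ -orient y v t * dotAt y s s :=
      mul_nonneg (by linarith) (dotAt_self_nonneg _ _)
    have h8 : orient y s t < 0 := by
      by_contra hn
      push Not at hn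
      have := mul_nonneg hn (dotAt_self_nonneg y v)
      linarith
    linarith [h s hs t ht hos hot h8]
  obtain ⟨τ, hτ₁, hτ₂⟩ : ∃ τ, (∀ t ∈ N, orient y v t < 0 → φ t ≤ τ) ∧
      ∀ s ∈ N, 0 < orient y v s → τ ≤ φ s := by
    have hA : (φ '' {t ∈ N | orient y v t < 0}).Finite := (hN.subset (Set.sep_subset _ _)).image _
    have hB : (φ '' {t ∈ N | 0 < orient y v t}).Finite := (hN.subset (Set.sep_subset _ _)).image _
    rcases Set.eq_empty_or_nonempty (φ '' {t ∈ N | orient y v t < 0}) with hA' | hA'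
    · obtain ⟨τ, hτ⟩ := hB.bddBelow
      refine ⟨τ, fun t ht hot => ?_, fun s hs hos => hτ ⟨s, ⟨hs, hos⟩, rfl⟩⟩
      have : φ t ∈ φ '' {t ∈ N | orient y v t < 0} := ⟨t, ⟨ht, hot⟩, rfl⟩
      rw [hA'] at this
      exact this.elim
    · refine ⟨sSup (φ '' {t ∈ N | orient y v t < 0}), fun t ht hot =>
        le_csSup hA.bddAbove ⟨t, ⟨ht, hot⟩, rfl⟩, fun s hs hos => csSup_le hA' ?_⟩
      rintro _ ⟨t, ⟨ht, hot⟩, rfl⟩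
      exact key s hs t ht hos hot
  set c : Plane := !₂[y 0 + (v 0 - y 0) / 2 - τ * (v 1 - y 1),
    y 1 + (v 1 - y 1) / 2 + τ * (v 0 - y 0)] with hc
  have hdot : ∀ q, 2 * dotAt y q c = dotAt y q v + 2 * (τ * orient y v q) := by
    intro q
    simp only [hc, dotAt, orient, PiLp.toLp_apply, Matrix.cons_val_zero, Matrix.cons_val_one]
    ring
  have hvv : orient y v v = 0 := by
    unfold orient
    ring
  refine ⟨c, dist_eq_iff_dotAt.2 (by rw [hdot, hvv]; ring), fun q hq => dist_le_iff_dotAt.2 ?_⟩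
  rw [hdot]
  rcases lt_trichotomy (orient y v q) 0 with ho | ho | ho
  · have := mul_le_mul_of_nonpos_right (hτ₁ q hq ho) ho.le
    linarith [hmul q ho.ne]
  · rcases hcol q hq ho with rfl | rfl
    · simp [dotAt, ho]
    · simp [ho]
  · have := mul_le_mul_of_nonneg_right (hτ₂ q hq ho) ho.le
    linarith [hmul q ho.ne']

/-- If `yv` is not a Delaunay edge of `N`, a Delaunay face at `y` lies in the direction of `v`. -/
theorem exists_face_of_not_weakDel {N : Set Plane} (hN : N.Finite) {y v : Plane}
    (hcol : ∀ q ∈ N, orient y v q = 0 → q = y ∨ q = v) (h : ¬ WeakDel N y v) :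
    ∃ s ∈ N, ∃ t ∈ N, ∃ c, 0 < orient y v s ∧ orient y v t < 0 ∧ orient y s t < 0 ∧
      dist s c = dist y c ∧ dist t c = dist y c ∧ ∀ q ∈ N, dist y c ≤ dist q c := by
  -- By `cone_dotAt`, `F (s, t)` is `2 (v - y)·(c - y)` for the circumcentre `c` of `yst`: up to the
  -- factor `|yv|²`, the parameter where the circle meets the line `yv` again. The value is below
  -- `|yv|²` exactly when `v` is outside the circle.
  set F : Plane × Plane → ℝ := fun p =>
    (orient y v p.1 * dotAt y p.2 p.2 - orient y v p.2 * dotAt y p.1 p.1) /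
      -(orient y p.1 p.2) with hF
  set T : Set (Plane × Plane) := {p ∈ N ×ˢ N | 0 < orient y v p.1 ∧ orient y v p.2 < 0 ∧
    orient y p.1 p.2 < 0} with hT
  have hTfin : T.Finite := (hN.prod hN).subset (Set.sep_subset _ _)
  obtain ⟨p₀, hp₀, hFp₀⟩ : ∃ p ∈ T, F p < dotAt y v v := by
    by_contra hneg
    push Not at hneg
    refine h (weakDel_of_forall hN hcol fun s hs t ht hos hot hst => ?_)
    have := hneg (s, t) ⟨⟨hs, ht⟩, hos, hot, hst⟩
    simp only [hF] at this
    rw [le_div_iff₀ (by linarith)] at this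
    linarith
  obtain ⟨⟨s, t⟩, hst, hmin⟩ := Set.exists_min_image T F hTfin ⟨p₀, hp₀⟩
  obtain ⟨⟨hs, ht⟩, hos, hot, hor⟩ := hst
  simp only at hs ht hos hot hor
  obtain ⟨c, hsc, htc⟩ := exists_circumcentre hor.ne
  refine ⟨s, hs, t, ht, c, hos, hot, hor, hsc, htc, fun q hq => ?_⟩
  rw [dist_eq_iff_dotAt] at hsc htc
  rw [dist_le_iff_dotAt]
  have hFst : F (s, t) = 2 * dotAt y v c := by
    simp only [hF]
    rw [div_eq_iff (by linarith)]
    have := cone_dotAt y v s t c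
    rw [← hsc, ← htc]
    linarith
  have hFnn : 0 ≤ F (s, t) := by
    have h1 : 0 ≤ orient y v s * dotAt y t t := mul_nonneg hos.le (dotAt_self_nonneg _ _)
    have h2 : 0 ≤ -orient y v t * dotAt y s s :=
      mul_nonneg (by linarith) (dotAt_self_nonneg _ _)
    exact div_nonneg (by simp only; linarith) (by simp only; linarith)
  have hFv : F (s, t) < dotAt y v v := (hmin p₀ hp₀).trans_lt hFp₀
  rw [hFst] at hFnn hFv
  by_contra hneg
  push Not at hneg
  -- A point `q` inside the disk of the minimal pair could replace `s` or `t`, whichever is on its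
  -- side of `yv`, and give a smaller `F`.
  rcases lt_trichotomy (orient y v q) 0 with ho | ho | ho
  · have h1 := cone_dotAt y v s q c
    have h2 : 0 ≤ -orient y v q * dotAt y s s :=
      mul_nonneg (by linarith) (dotAt_self_nonneg _ _)
    have h3 : 0 ≤ orient y v s * dotAt y q q := mul_nonneg hos.le (dotAt_self_nonneg _ _)
    have h4 := mul_lt_mul_of_pos_left hneg hos
    have h5 : orient y v s * dotAt y q q - orient y v q * dotAt y s s <
        2 * dotAt y v c * -(orient y s q) := by
      rw [← hsc] at h2 ⊢
      linarith
    have h6 : orient y s q < 0 := by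
      by_contra hn
      push Not at hn
      have := mul_nonneg hFnn hn
      linarith
    have h7 := hmin (s, q) ⟨⟨hs, hq⟩, hos, ho, h6⟩
    rw [hFst] at h7
    simp only [hF] at h7
    rw [le_div_iff₀ (by linarith)] at h7
    linarith
  · rcases hcol q hq ho with rfl | rfl
    · simp [dotAt] at hneg
    · linarith
  · have h1 := cone_dotAt y v q t c
    have h2 : 0 ≤ orient y v q * dotAt y t t := mul_nonneg ho.le (dotAt_self_nonneg _ _)
    have h3 : 0 ≤ -orient y v t * dotAt y q q :=
      mul_nonneg (by linarith) (dotAt_self_nonneg _ _)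
    have h4 := mul_lt_mul_of_pos_left hneg (neg_pos.2 hot)
    have h5 : orient y v q * dotAt y t t - orient y v t * dotAt y q q <
        2 * dotAt y v c * -(orient y q t) := by
      rw [← htc] at h2 ⊢
      linarith
    have h6 : orient y q t < 0 := by
      by_contra hn
      push Not at hn
      have := mul_nonneg hFnn hn
      linarith
    have h7 := hmin (q, t) ⟨⟨hq, ht⟩, ho, hot, h6⟩
    rw [hFst] at h7
    simp only [hF] at h7
    rw [le_div_iff₀ (by linarith)] at h7
    linarith

/-! ### Surviving edges are Delaunay from both endpoints -/

theorem nbhd_finite (V : Finset Plane) (v : Plane) : (nbhd V v).Finite :=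
  V.finite_toSet.subset fun _ h => h.1

/-- Comparison of two circles on crossing segments. -/
theorem power_le_of_pt_eq_pt {c c' a b s t : Plane} {r r' u w : ℝ} (hu0 : 0 ≤ u) (hu1 : u ≤ 1)
    (hw0 : 0 ≤ w) (hw1 : w ≤ 1) (h : pt a b u = pt s t w)
    (ha : power c' r' a ≤ power c r a) (hb : power c' r' b ≤ power c r b) :
    power c' r' s ≤ power c r s ∨ power c' r' t ≤ power c r t := by
  by_contra hn
  push Not at hn
  have h1 : power c' r' (pt a b u) ≤ power c r (pt a b u) := by
    rw [power_pt, power_pt]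
    have := mul_le_mul_of_nonneg_left ha (sub_nonneg.2 hu1)
    have := mul_le_mul_of_nonneg_left hb hu0
    linarith
  rw [h, power_pt, power_pt] at h1
  rcases hw0.eq_or_lt with rfl | hw
  · linarith [hn.1]
  · have := mul_le_mul_of_nonneg_left hn.1.le (sub_nonneg.2 hw1)
    have := mul_lt_mul_of_pos_left hn.2 hw
    linarith

theorem dotAt_comm (x a b : Plane) : dotAt x a b = dotAt x b a := by
  unfold dotAt
  ring

/-- A face at `y` whose side `st` is crossed by `yv` is not mixed from the point of view of `v`. -/
theorem Kept.not_face {V : Finset Plane} (hV : GeneralPosition V) {v y s t c : Plane} {a b : ℝ}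
    (hk : Kept V v y) (hyV : y ∈ V) (hvy : v ≠ y) (hyv1 : dist y v ≤ 1)
    (hs : s ∈ nbhd V y) (ht : t ∈ nbhd V y) (hsy : s ≠ y) (hty : t ≠ y)
    (ha : 0 ≤ a) (hb : 0 ≤ b)
    (hc0 : v 0 - y 0 = a * (s 0 - y 0) + b * (t 0 - y 0))
    (hc1 : v 1 - y 1 = a * (s 1 - y 1) + b * (t 1 - y 1))
    (hsf : 1 < dist s v) (htn : dist t v ≤ 1) (hsc : dist s c = dist y c)
    (htc : dist t c = dist y c) (hempty : ∀ q ∈ nbhd V y, dist y c ≤ dist q c) :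
    ¬ Cross v y t s := by
  intro hcross
  have hang : 2 * dotAt y s t < dist s y * dist t y :=
    two_dotAt_lt_of_cone ha hb hc0 hc1 (two_dotAt_lt hs.2 (by rwa [dist_comm]) hsf)
  refine hk.not_removed hV hyV ht.1 hs.1 hvy.symm hty hsy hyv1 htn hsf ht.2 hs.2 (by simp)
    htc hsc hempty ?_ (Or.inr hcross)
  rw [dotAt_comm]
  linarith

/-- An edge that survives at `v` is Delaunay from the point of view of its other endpoint. -/
theorem Kept.weakDel_right {V : Finset Plane} (hV : GeneralPosition V) {v y : Plane}
    (hk : Kept V v y) : WeakDel (nbhd V y) y v := by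
  by_contra hneg
  obtain ⟨hvy, o, r, hdel⟩ := hk.delaunayEdge
  have hvN := hdel.power_left.1
  have hyN := hdel.power_right.1
  have hDv := hdel.power_left.2
  have hDy := hdel.power_right.2
  have hvy1 : dist v y ≤ 1 := by
    rw [dist_comm]
    exact hyN.2
  obtain ⟨s, hs, t, ht, c, hos, hot, hst, hsc, htc, hempty⟩ :=
    exists_face_of_not_weakDel (nbhd_finite V y) (y := y) (v := v) (fun q hq h0 => by
      by_contra hne
      push Not at hne
      exact hV.orient_ne_zero hyN.1 hvN.1 hq.1 hvy.symm hne.1.symm hne.2.symm h0) hneg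
  have hyv_orient : ∀ q, orient v y q = -orient y v q := by
    intro q
    unfold orient
    ring
  have hky : power c (dist y c) y = 0 := power_eq_zero_of_eq rfl
  have hks : power c (dist y c) s = 0 := power_eq_zero_of_eq hsc
  have hkt : power c (dist y c) t = 0 := power_eq_zero_of_eq htc
  have hkv : 0 ≤ power c (dist y c) v := power_nonneg_of_le (hempty v ⟨hvN.1, hvy1⟩)
  have hside : orient v y s * orient v y t < 0 := by
    rw [hyv_orient, hyv_orient]
    nlinarith
  have hne : s ≠ t := by
    rintro rfl
    linarith
  have hsv : s ≠ v := by
    rintro rfl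
    simp [orient, mul_comm] at hos
  have hsy : s ≠ y := by
    rintro rfl
    simp [orient] at hos
  have htv : t ≠ v := by
    rintro rfl
    simp [orient, mul_comm] at hot
  have hty : t ≠ y := by
    rintro rfl
    simp [orient] at hot
  -- the coordinates of `v` in the cone spanned by `s` and `t`
  set k := -(orient y s t) with hk_def
  have hkpos : 0 < k := by linarith
  have hc0 : v 0 - y 0 = -orient y v t / k * (s 0 - y 0) + orient y v s / k * (t 0 - y 0) := by
    field_simp
    rw [hk_def]
    unfold orient
    ring
  have hc1 : v 1 - y 1 = -orient y v t / k * (s 1 - y 1) + orient y v s / k * (t 1 - y 1) := by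
    field_simp
    rw [hk_def]
    unfold orient
    ring
  set a := -orient y v t / k with ha_def
  set b := orient y v s / k with hb_def
  have ha : 0 < a := div_pos (by linarith) hkpos
  have hb : 0 < b := div_pos hos hkpos
  have hpt : pt y v (1 / (a + b)) = pt s t (b / (a + b)) := by
    apply plane_ext <;> simp only [pt_apply] <;> field_simp
    · linear_combination hc0
    · linear_combination hc1
  have hb1 : 0 < b / (a + b) := by positivity
  have hb2 : b / (a + b) < 1 := by
    rw [div_lt_one (by linarith)]
    linarith
  have hu : 0 < 1 / (a + b) := by positivity
  set u := 1 / (a + b)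
  set w := b / (a + b)
  have hneg' : power c (dist y c) (pt y v u) < 0 := by
    rw [hpt, power_pt, hks, hkt]
    have := mul_pos (mul_pos hb1 (sub_pos.2 hb2)) (dist_sq_pos hne)
    linarith
  have hu1 : u < 1 := by
    by_contra hn
    push Not at hn
    rw [power_pt, hky] at hneg'
    nlinarith [mul_nonneg (mul_nonneg hu.le (sub_nonneg.2 hn)) (sq_nonneg (dist y v)),
      mul_nonneg hu.le hkv]
  have hcross : Cross v y s t := by
    refine Cross.symm_left ((cross_iff hvy.symm).2 ⟨?_, u, w, hu, hu1, hb1, hb2, hpt⟩)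
    nlinarith
  -- one of `s`, `t` lies in the disk of `vy`, hence is far from `v`
  have hfar : 1 < dist s v ∨ 1 < dist t v := by
    by_contra hn
    push Not at hn
    have h1 := hdel.power_pos (q := s) ⟨hs.1, hn.1⟩ hsv hsy
    have h2 := hdel.power_pos (q := t) ⟨ht.1, hn.2⟩ htv hty
    rcases power_le_of_pt_eq_pt (c := c) (c' := o) (r := dist y c) (r' := r) hu.le hu1.le hb1.le
      hb2.le hpt (by rw [hDy, hky]) (by rwa [hDv]) with h | h <;> linarith
  -- The unit disk of `v` has nonpositive power at `y` and `v`, so it cannot have larger power than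
  -- the face's circle at both `s` and `t`.
  have hnear : dist s v ≤ 1 ∨ dist t v ≤ 1 := by
    by_contra hn
    push Not at hn
    have h1 := power_one_pos hn.1
    have h2 := power_one_pos hn.2
    rcases power_le_of_pt_eq_pt (c := c) (c' := v) (r := dist y c) (r' := 1) hu.le hu1.le hb1.le
      hb2.le hpt (by rw [hky]; exact power_one_nonpos hyN.2)
      (by rw [power_self_one]; linarith) with h | h <;> linarith
  have hyv1 : dist y v ≤ 1 := hyN.2
  by_cases hsf : 1 < dist s v
  · exact hk.not_face hV hyN.1 hvy hyv1 hs ht hsy hty ha.le hb.le hc0 hc1 hsf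
      (hnear.resolve_left (not_le.2 hsf)) hsc htc hempty hcross.symm_right
  · exact hk.not_face hV hyN.1 hvy hyv1 ht hs hty hsy hb.le ha.le (by rw [hc0, add_comm])
      (by rw [hc1, add_comm]) (hfar.resolve_left hsf) (not_lt.1 hsf) htc hsc hempty hcross

/-! ### Moving empty disks, and caps of disks -/

theorem mul_neg_trans {a b c : ℝ} (h₁ : a * b < 0) (h₂ : 0 < b * c) : a * c < 0 := by
  by_contra hn
  have h3 : 0 ≤ b ^ 2 * (a * c) := mul_nonneg (sq_nonneg b) (not_lt.1 hn)
  have h4 : a * b * (b * c) < 0 := mul_neg_of_neg_of_pos h₁ h₂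
  linarith [show a * b * (b * c) = b ^ 2 * (a * c) by ring]

theorem mul_pos_trans {a b c : ℝ} (h₁ : 0 < a * b) (h₂ : 0 < b * c) : 0 < a * c := by
  have := mul_neg_trans (a := -a) (b := b) (c := c) (by linarith) h₂
  linarith

theorem mul_nonpos_trans {a b c : ℝ} (h₁ : a * b < 0) (h₂ : 0 ≤ b * c) : a * c ≤ 0 := by
  rcases h₂.eq_or_lt with h | h
  · have hb : b ≠ 0 := by
      rintro rfl
      simp at h₁
    rw [(mul_eq_zero.1 h.symm).resolve_left hb, mul_zero]
  · exact (mul_neg_trans h₁ h).le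

/-- Pushing an empty disk through `x` and `w` to the side of `v` until it meets a third point. -/
theorem exists_third_vertex {N : Set Plane} (hN : N.Finite) {x w v : Plane}
    (h : WeakDel N x w) (hv : v ∈ N) (hor : 0 < orient x w v) :
    ∃ t ∈ N, ∃ c, 0 < orient x w t ∧ dist w c = dist x c ∧ dist t c = dist x c ∧
      ∀ q ∈ N, dist x c ≤ dist q c := by
  obtain ⟨c₀, hwc, hempty⟩ := h
  -- `φ q` is the shift of the centre along the normal of `xw` at which the circle reaches `q`; the
  -- least one on the side of `v` gives `t`.
  set φ : Plane → ℝ := fun q => (dotAt x q q - 2 * dotAt x q c₀) / (2 * orient x w q) with hφ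
  obtain ⟨t, ⟨ht, hot⟩, hmin⟩ := Set.exists_min_image {q ∈ N | 0 < orient x w q} φ
    (hN.subset (Set.sep_subset _ _)) ⟨v, hv, hor⟩
  have hmul : ∀ q, orient x w q ≠ 0 →
      2 * (φ q * orient x w q) = dotAt x q q - 2 * dotAt x q c₀ := by
    intro q hq
    simp only [hφ]
    field_simp
  set τ := φ t with hτ
  have hτ0 : 0 ≤ τ := by
    have := dist_le_iff_dotAt.1 (hempty t ht)
    exact div_nonneg (by linarith) (by linarith)
  set c : Plane := !₂[c₀ 0 - τ * (w 1 - x 1), c₀ 1 + τ * (w 0 - x 0)] with hc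
  have hdot : ∀ q, 2 * dotAt x q c = 2 * dotAt x q c₀ + 2 * (τ * orient x w q) := by
    intro q
    simp only [hc, dotAt, orient, Matrix.cons_val_zero, Matrix.cons_val_one]
    ring
  have hww : orient x w w = 0 := by
    unfold orient
    ring
  refine ⟨t, ht, c, hot, ?_, ?_, fun q hq => ?_⟩
  · rw [dist_eq_iff_dotAt] at hwc ⊢
    rw [hdot, hww, hwc]
    ring
  · rw [dist_eq_iff_dotAt, hdot, hmul t hot.ne']
    ring
  · rw [dist_le_iff_dotAt, hdot]
    have h0 := dist_le_iff_dotAt.1 (hempty q hq)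
    rcases le_or_gt (orient x w q) 0 with ho | ho
    · linarith [mul_nonpos_of_nonneg_of_nonpos hτ0 ho]
    · have := mul_le_mul_of_nonneg_right (hmin q ⟨hq, ho⟩) ho.le
      linarith [hmul q ho.ne']

/-- Shrinking a disk towards its boundary point `t` yields a Delaunay edge at `t`. -/
theorem exists_weakDel_of_disk {N : Set Plane} (hN : N.Finite) {t w c : Plane} (hw : w ∈ N)
    (hwt : w ≠ t) (hwc : dist w c = dist t c) :
    ∃ q ∈ N, q ≠ t ∧ WeakDel N t q ∧ (dist q c < dist t c ∨ q = w) := by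
  rcases Set.eq_empty_or_nonempty {q ∈ N | dist q c < dist t c} with he | hne
  · refine ⟨w, hw, hwt, ⟨c, hwc, fun q hq => ?_⟩, Or.inr rfl⟩
    by_contra hn
    have : q ∈ {q ∈ N | dist q c < dist t c} := ⟨hq, not_le.1 hn⟩
    rw [he] at this
    exact this
  · obtain ⟨q, ⟨hq, hqc⟩, hmin⟩ := Set.exists_min_image {q ∈ N | dist q c < dist t c}
      (fun q => dotAt t q q / (2 * dotAt t q c)) (hN.subset (Set.sep_subset _ _)) hne
    have hlt : ∀ p, dist p c < dist t c → dotAt t p p < 2 * dotAt t p c := by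
      intro p hp
      by_contra hn
      exact (not_le.2 hp) (dist_le_iff_dotAt.2 (not_lt.1 hn))
    have h1 := hlt q hqc
    have h2 := dotAt_self_nonneg t q
    -- The homothety at `t` with ratio `σ` makes the circle pass through `q`; the minimal ratio
    -- leaves the disk empty.
    set σ := dotAt t q q / (2 * dotAt t q c) with hσ
    have hσ0 : 0 ≤ σ := div_nonneg h2 (by linarith)
    have hσ1 : σ ≤ 1 := (div_le_one (by linarith)).2 h1.le
    have hσq : σ * (2 * dotAt t q c) = dotAt t q q := div_mul_cancel₀ _ (by linarith)
    have hdot : ∀ p, 2 * dotAt t p (pt t c σ) = σ * (2 * dotAt t p c) := by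
      intro p
      simp only [dotAt, pt_apply]
      ring
    refine ⟨q, hq, ?_, ⟨pt t c σ, ?_, fun p hp => ?_⟩, Or.inl hqc⟩
    · rintro rfl
      exact lt_irrefl _ hqc
    · rw [dist_eq_iff_dotAt, hdot, hσq]
    · rw [dist_le_iff_dotAt, hdot]
      have h3 := dotAt_self_nonneg t p
      rcases lt_or_ge (dist p c) (dist t c) with hpc | hpc
      · have h4 := hlt p hpc
        have h5 := hmin p ⟨hp, hpc⟩
        have h6 := (le_div_iff₀ (by linarith)).1 h5
        exact h6
      · have h4 := dist_le_iff_dotAt.1 hpc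
        rcases le_or_gt (2 * dotAt t p c) 0 with h5 | h5
        · linarith [mul_nonpos_of_nonneg_of_nonpos hσ0 h5]
        · nlinarith

/-- The cap of a disk on the side of `vy` opposite to the centre has diameter at most `|vy|`. -/
theorem dist_le_on_small_cap {c v y p q : Plane} {r s : ℝ} (hvy : v ≠ y)
    (hv : 0 ≤ power c r v) (hy : 0 ≤ power c r y) (hs0 : 0 < s) (hs1 : s < 1)
    (hs : power c r (pt v y s) < 0) (hp : power c r p ≤ 0) (hq : power c r q ≤ 0)
    (hpc : orient v y c * orient v y p ≤ 0) (hqc : orient v y c * orient v y q ≤ 0) :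
    dist p q ≤ dist v y := by
  have hD := dist_sq_pos hvy
  -- Parameter of the foot of the perpendicular from the centre. The cap lies in the disk about the
  -- foot with squared radius minus the foot's power, while `v` and `y` are not inside it.
  set f := dotAt v y c / dist v y ^ 2 with hf
  have hfD : f * dist v y ^ 2 = dotAt v y c := div_mul_cancel₀ _ hD.ne'
  have hfoot : ∀ a, (power c r a - power c r (pt v y f) - dist a (pt v y f) ^ 2) * dist v y ^ 2 =
      -2 * (orient v y c * orient v y a) := by
    intro a
    simp only [dist_sq, power, dotAt, orient, pt_apply] at hfD ⊢
    linear_combination (2 * ((y 0 - v 0) * (a 0 - v 0) + (y 1 - v 1) * (a 1 - v 1)) -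
      2 * f * ((v 0 - y 0) ^ 2 + (v 1 - y 1) ^ 2)) * hfD
  have hline : ∀ u, orient v y c * orient v y (pt v y u) = 0 := by
    intro u
    rw [orient_self_pt, mul_zero]
  have hneg : power c r (pt v y f) < 0 := by
    have h1 := hfoot (pt v y s)
    rw [hline] at h1
    have h2 := (mul_eq_zero.1 (h1.trans (by ring))).resolve_right hD.ne'
    nlinarith [sq_nonneg (dist (pt v y s) (pt v y f))]
  obtain ⟨hf0, hf1⟩ := param_mem_of_power hv hy hs0 hs1 hs hneg.le
  have hcap : ∀ a, power c r a ≤ 0 → orient v y c * orient v y a ≤ 0 →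
      dist a (pt v y f) ^ 2 ≤ -power c r (pt v y f) := by
    intro a ha hac
    have h1 := hfoot a
    by_contra hn
    push Not at hn
    have : (power c r a - power c r (pt v y f) - dist a (pt v y f) ^ 2) * dist v y ^ 2 < 0 :=
      mul_neg_of_neg_of_pos (by linarith) hD
    linarith
  have hend : ∀ a, 0 ≤ power c r a → orient v y a = 0 →
      -power c r (pt v y f) ≤ dist a (pt v y f) ^ 2 := by
    intro a ha ha0
    have h1 := hfoot a
    rw [ha0, mul_zero, mul_zero] at h1
    have h2 := (mul_eq_zero.1 h1).resolve_right hD.ne'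
    linarith
  have h1 : dist p (pt v y f) ≤ dist v (pt v y f) :=
    abs_le_of_sq_le_sq' ((hcap p hp hpc).trans (hend v hv (by unfold orient; ring)))
      dist_nonneg |>.2
  have h2 : dist q (pt v y f) ≤ dist y (pt v y f) :=
    abs_le_of_sq_le_sq' ((hcap q hq hqc).trans (hend y hy (by unfold orient; ring)))
      dist_nonneg |>.2
  have h3 : dist v (pt v y f) = f * dist v y := by
    rw [← sq_eq_sq₀ dist_nonneg (by positivity), mul_pow, dist_sq, dist_sq]
    simp only [pt_apply]
    ring
  have h4 : dist y (pt v y f) = (1 - f) * dist v y := by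
    rw [← sq_eq_sq₀ dist_nonneg (mul_nonneg (by linarith) dist_nonneg), mul_pow, dist_sq, dist_sq]
    simp only [pt_apply]
    ring
  have h5 := dist_triangle_right p q (pt v y f)
  linarith

/-- The centre of a disk crossed by `vy` lies on the same side as a point `w` of the disk that is
invisible from `v`. -/
theorem centre_side {c v y w : Plane} {r s : ℝ} (hvy : v ≠ y) (hyv : dist y v ≤ 1)
    (hv : 0 ≤ power c r v) (hy : 0 ≤ power c r y) (hs0 : 0 < s) (hs1 : s < 1)
    (hs : power c r (pt v y s) < 0) (hw : power c r w ≤ 0) (hw0 : orient v y w ≠ 0)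
    (hwv : 1 < dist w v) : 0 < orient v y w * orient v y c := by
  by_contra hn
  push Not at hn
  have hD := dist_sq_pos hvy
  set k := 2 * orient v y w / dist v y ^ 2 with hk
  have hkD : k * dist v y ^ 2 = 2 * orient v y w := div_mul_cancel₀ _ hD.ne'
  -- Mirror image of `w` in the line `vy`: still invisible from `v` and, were the centre not on the
  -- side of `w`, still in the disk. The cap comparison with the unit disk forbids this.
  set w' : Plane := !₂[w 0 + k * (y 1 - v 1), w 1 - k * (y 0 - v 0)] with hw'
  have h0 : orient v y w' = -orient v y w := by
    rw [dist_sq] at hkD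
    simp only [orient, hw', Matrix.cons_val_zero, Matrix.cons_val_one] at hkD ⊢
    linear_combination -hkD
  have h1 : dist w' v ^ 2 = dist w v ^ 2 := by
    rw [dist_sq] at hkD
    rw [dist_sq, dist_sq]
    simp only [orient, hw', Matrix.cons_val_zero, Matrix.cons_val_one] at hkD ⊢
    linear_combination k * hkD
  have h2 : power c r w' = power c r w + 2 * k * orient v y c := by
    rw [dist_sq] at hkD
    rw [power, power, dist_sq, dist_sq]
    simp only [orient, hw', Matrix.cons_val_zero, Matrix.cons_val_one] at hkD ⊢
    linear_combination k * hkD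
  have h3 : k * orient v y c ≤ 0 := by
    have : k * orient v y c * dist v y ^ 2 = 2 * (orient v y w * orient v y c) := by
      linear_combination orient v y c * hkD
    by_contra hpos
    push Not at hpos
    have := mul_pos hpos hD
    linarith
  have h4 := power_le_on_cap (c' := v) (r' := 1) (q := w') hvy hv hy hs0 hs1 hs hw (by linarith)
    hw0 (by rw [h0]; nlinarith [mul_self_nonneg (orient v y w)])
    (by rw [power_self_one]; linarith) ((power_one_nonpos hyv).trans hy)
    (hw.trans_lt (power_one_pos hwv))
  have h5 := power_one_pos hwv
  unfold power at h4 h5 h2 hw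
  linarith

/-! ### Descent on obstructing edges -/

/-- The point `x` sees `v` and `y`, and from its point of view `xw` is a Delaunay edge, which
crosses `vy`. -/
structure Obstructs (V : Finset Plane) (v y x w : Plane) : Prop where
  left_mem : x ∈ V
  right_mem : w ∈ V
  dist_v : dist x v ≤ 1
  dist_y : dist x y ≤ 1
  dist_le : dist w x ≤ 1
  cross : Cross v y x w
  weakDel : WeakDel (nbhd V x) x w

/-- If `t` is across `vy` from `x`, then `xt` obstructs. Otherwise `t` is visible from `v` and `w`
is not, so survival of `vy` forces the angle `txw` to be at most π/3. This gives `|wt| ≤ 1` and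
places `t` in the triangle `xvy`; shrinking the disk towards `t` yields an edge `tq` crossing `vy`.
-/
theorem Kept.obstructs_step {V : Finset Plane} (hV : GeneralPosition V) {v y x w t c : Plane}
    (hk : Kept V v y) (h : Obstructs V v y x w) (ht : t ∈ nbhd V x)
    (hside : 0 < orient x w t * orient x w v) (hwc : dist w c = dist x c)
    (htc : dist t c = dist x c) (hempty : ∀ q ∈ nbhd V x, dist x c ≤ dist q c) :
    Obstructs V v y x t ∨ ∃ q, Obstructs V v y t q ∧ |orient v y t| < |orient v y x| := by
  obtain ⟨hx, hw, hxv1, hxy1, hwx1, hcross, -⟩ := h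
  obtain ⟨hvy, o, r, hdel⟩ := hk.delaunayEdge
  have hvN := hdel.power_left.1
  have hyN := hdel.power_right.1
  have hvx1 : dist v x ≤ 1 := by rwa [dist_comm]
  have hyx1 : dist y x ≤ 1 := by rwa [dist_comm]
  obtain ⟨hxw, s, u, hs0, hs1, hu0, hu1, hsu⟩ := (cross_iff hvy).1 hcross
  have hx0 : orient v y x ≠ 0 := left_ne_zero_of_mul hxw.ne
  have hw0 : orient v y w ≠ 0 := right_ne_zero_of_mul hxw.ne
  have hne_xw : x ≠ w := by
    rintro rfl
    nlinarith [mul_self_nonneg (orient v y x)]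
  have hxv : x ≠ v := by
    rintro rfl
    exact hx0 (by simp [orient])
  have hxy : x ≠ y := by
    rintro rfl
    exact hx0 (by unfold orient; ring)
  have hkx : power c (dist x c) x = 0 := power_eq_zero_of_eq rfl
  have hkw : power c (dist x c) w = 0 := power_eq_zero_of_eq hwc
  have hkt : power c (dist x c) t = 0 := power_eq_zero_of_eq htc
  have hkv : 0 ≤ power c (dist x c) v := power_nonneg_of_le (hempty v ⟨hvN.1, hvx1⟩)
  have hky : 0 ≤ power c (dist x c) y := power_nonneg_of_le (hempty y ⟨hyN.1, hyx1⟩)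
  have hks : power c (dist x c) (pt v y s) < 0 := by
    rw [hsu, power_pt, hkx, hkw]
    have := mul_pos (mul_pos hu0 (sub_pos.2 hu1)) (dist_sq_pos hne_xw)
    linarith
  have hwv : w ≠ v := by
    rintro rfl
    exact hw0 (by simp [orient])
  have hwy : w ≠ y := by
    rintro rfl
    exact hw0 (by unfold orient; ring)
  -- Otherwise `x` and `w` would both be outside the Delaunay disk of `vy`, although `xw` crosses
  -- `vy`.
  have hwfar : 1 < dist w v := by
    by_contra hn
    have h1 := hdel.power_pos (q := w) ⟨hw, not_lt.1 hn⟩ hwv hwy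
    have h2 := hdel.power_pos (q := x) ⟨hx, hxv1⟩ hxv hxy
    rcases power_le_of_pt_eq_pt (c := c) (c' := o) (r := dist x c) (r' := r) hs0.le hs1.le hu0.le
      hu1.le hsu (by rwa [hdel.power_left.2]) (by rwa [hdel.power_right.2]) with h | h <;> linarith
  have hxwt : orient x w t ≠ 0 := left_ne_zero_of_mul hside.ne'
  have htx : t ≠ x := by
    rintro rfl
    exact hxwt (by simp [orient])
  have htw : t ≠ w := by
    rintro rfl
    exact hxwt (by unfold orient; ring)
  have hsides := ((cross_iff hne_xw).1 hcross.swap).1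
  have htv : t ≠ v := by
    rintro rfl
    refine hk.not_removed hV hx hvN.1 hw hxv hxv.symm hne_xw.symm hxv1 (by simp) hwfar hvx1 hwx1
      hyx1 htc hwc hempty ?_ (Or.inl hcross)
    exact two_dotAt_lt hvx1 hwx1 (by rwa [dist_comm])
  have hty : t ≠ y := by
    rintro rfl
    linarith [mul_comm (orient x w v) (orient x w t)]
  have ht0 := hV.orient_ne_zero hvN.1 hyN.1 ht.1 hvy htv.symm hty.symm
  rcases lt_or_gt_of_ne (mul_ne_zero hx0 ht0) with hxt | hxt
  · left
    exact ⟨hx, ht.1, hxv1, hxy1, ht.2,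
      cross_of_power hvy hkv hky hs0 hs1 hks hkx.le hkt.le hxt, c, htc, hempty⟩
  right
  have hwx : orient v y w * orient v y x < 0 := by rwa [mul_comm]
  have hwt : orient v y w * orient v y t < 0 := mul_neg_trans hwx hxt
  have htv1 : dist t v ≤ 1 := by
    apply dist_le_one_of_power
    have := power_le_on_cap (c' := v) (r' := 1) hvy hkv hky hs0 hs1 hks hkw.le hkt.le hw0 hwt.le
      (by rw [power_self_one]; linarith) ((power_one_nonpos hyN.2).trans hky)
      (by rw [hkw]; exact power_one_pos hwfar)
    linarith
  have hangle : ¬ 2 * dotAt x t w < dist t x * dist w x := fun hang =>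
    hk.not_removed hV hx ht.1 hw hxv htx hne_xw.symm hxv1 htv1 hwfar ht.2 hwx1
      hyx1 htc hwc hempty hang (Or.inl hcross)
  have htw1 : dist w t ≤ 1 := by
    by_contra hn
    exact hangle (two_dotAt_lt ht.2 hwx1 (by rw [dist_comm]; exact not_le.1 hn))
  have hxvt := hV.orient_ne_zero hx hvN.1 ht.1 hxv htx.symm htv.symm
  -- If `t` were beyond `xv`, the cone `txw` would contain `v`. As `|wv| > 1`, the angle `vxw`
  -- exceeds π/3, and so would `txw`.
  have hinside : 0 < orient x v t * orient x v w := by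
    by_contra hn
    push Not at hn
    have hvw : orient x v w = -orient x w v := by
      unfold orient
      ring
    rw [hvw] at hn
    have hne := mul_self_pos.2 hxwt
    have hwv0 : orient x w v ≠ 0 := right_ne_zero_of_mul hside.ne'
    have h1 : 0 < orient x w v * orient x v t := by
      refine lt_of_le_of_ne (by linarith) (Ne.symm (mul_ne_zero hwv0 hxvt))
    have h2 := mul_pos_trans hside h1
    refine hangle ?_
    rw [dotAt_comm, mul_comm (dist t x)]
    refine two_dotAt_lt_of_cone (l := orient x v t / orient x w t)
      (m := orient x w v / orient x w t) (v := v) ?_ ?_ ?_ ?_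
      (two_dotAt_lt hwx1 hvx1 hwfar)
    · rw [← mul_div_mul_left _ _ hxwt]
      exact div_nonneg h2.le hne.le
    · rw [← mul_div_mul_left _ _ hxwt]
      exact div_nonneg hside.le hne.le
    · field_simp
      unfold orient
      ring
    · field_simp
      unfold orient
      ring
  -- `t` lies in the triangle `xvy`
  set X := orient v y x with hX
  set α := orient x t y / X with hα_def
  set β := orient x v t / X with hβ_def
  set γ := orient v y t / X with hγ_def
  have hXX := mul_self_pos.2 hx0
  have hsum : γ = 1 - α - β := by
    rw [hα_def, hβ_def, hγ_def]
    field_simp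
    rw [hX]
    unfold orient
    ring
  have hγ : 0 < γ := by
    rw [hγ_def, ← mul_div_mul_left _ _ hx0]
    exact div_pos hxt hXX
  have hβ : 0 < β := by
    rw [hβ_def, ← mul_div_mul_left _ _ hx0]
    refine div_pos ?_ hXX
    have h1 : s * X = u * orient x v w := by
      have e1 : orient x v (pt v y s) = s * X := by
        rw [orient_pt, hX]
        unfold orient
        ring
      have e2 : orient x v (pt x w u) = u * orient x v w := by
        rw [orient_pt]
        unfold orient
        ring
      rw [← e1, ← e2, hsu]
    have h2 : 0 < X * orient x v w := by
      have : u * (X * orient x v w) = s * (X * X) := by linear_combination -X * h1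
      have h3 : 0 < u * (X * orient x v w) := by
        rw [this]
        exact mul_pos hs0 hXX
      exact pos_of_mul_pos_right h3 hu0.le
    exact mul_pos_trans h2 (by rwa [mul_comm])
  have hα : 0 < α := by
    have h1 : orient x w t = α * orient x w v + β * orient x w y := by
      rw [hα_def, hβ_def]
      field_simp
      rw [hX]
      unfold orient
      ring
    have h2 : orient x w t * orient x w v =
        α * orient x w v ^ 2 + β * (orient x w v * orient x w y) := by
      rw [h1]
      ring
    have h3 := mul_neg_of_pos_of_neg hβ hsides
    have h4 : 0 < α * orient x w v ^ 2 := by linarith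
    exact pos_of_mul_pos_left h4 (sq_nonneg _)
  have hty1 : dist t y ≤ 1 := by
    have h1 : t - y = γ • (x - y) + α • (v - y) := by
      rw [hγ_def, hα_def]
      apply plane_ext <;> simp <;> field_simp <;> rw [hX] <;> unfold orient <;> ring
    rw [dist_eq_norm, h1]
    refine (norm_add_le _ _).trans ?_
    rw [norm_smul, norm_smul, Real.norm_of_nonneg hγ.le, Real.norm_of_nonneg hα.le,
      ← dist_eq_norm, ← dist_eq_norm]
    have h2 := mul_le_mul_of_nonneg_left hxy1 hγ.le
    have h3 : dist v y ≤ 1 := by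
      rw [dist_comm]
      exact hyN.2
    have h4 := mul_le_mul_of_nonneg_left h3 hα.le
    linarith
  obtain ⟨q, hq, hqt, hwd, hqw⟩ := exists_weakDel_of_disk (nbhd_finite V t) (c := c)
    ⟨hw, htw1⟩ htw.symm (hwc.trans htc.symm)
  rw [htc] at hqw
  have hcw := centre_side hvy hyN.2 hkv hky hs0 hs1 hks hkw.le hw0 hwfar
  have hkq : power c (dist x c) q ≤ 0 := by
    rcases hqw with h | rfl
    · unfold power
      nlinarith [dist_nonneg (x := q) (y := c)]
    · exact hkw.le
  -- The centre is on the side of `w`, so the cap on the side of `x` has diameter at most `|vy| ≤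
  -- 1`. A point `q` inside the disk in that cap would be visible from `x`, against emptiness.
  have htq : orient v y t * orient v y q < 0 := by
    rcases hqw with h | rfl
    · by_contra hn
      have h1 : orient v y c * X < 0 := by
        rw [mul_comm]
        exact mul_neg_trans hxw hcw
      have h2 : 0 < orient v y t * X := by rwa [mul_comm]
      have h3 : orient v y c * orient v y t < 0 := mul_neg_trans h1 hxt
      have h4 : orient v y c * orient v y q ≤ 0 := mul_nonpos_trans h3 (not_lt.1 hn)
      have h5 := dist_le_on_small_cap hvy hkv hky hs0 hs1 hks hkq hkx.le h4 h1.le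
      have h6 := hempty q ⟨hq.1, h5.trans (by rw [dist_comm]; exact hyN.2)⟩
      linarith
    · rwa [mul_comm]
  refine ⟨q, ⟨ht.1, hq.1, htv1, hty1, hq.2,
    cross_of_power hvy hkv hky hs0 hs1 hks hkt.le hkq htq, hwd⟩, ?_⟩
  have h1 : orient v y t = γ * X := by
    rw [hγ_def]
    field_simp
  rw [h1, abs_mul, abs_of_pos hγ]
  have h2 : 0 < |X| := abs_pos.2 hx0
  nlinarith

theorem Kept.exists_obstructs_step {V : Finset Plane} (hV : GeneralPosition V) {v y x w : Plane}
    (hk : Kept V v y) (h : Obstructs V v y x w) :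
    (∃ t, Obstructs V v y x t ∧ 0 < orient x w t * orient x w v) ∨
      ∃ t q, Obstructs V v y t q ∧ |orient v y t| < |orient v y x| := by
  obtain ⟨hvy, o, r, hdel⟩ := hk.delaunayEdge
  have hne : x ≠ w := by
    rintro rfl
    have := ((cross_iff hvy).1 h.cross).1
    nlinarith [mul_self_nonneg (orient v y x)]
  have hsides := ((cross_iff hne).1 h.cross.swap).1
  have hv : v ∈ nbhd V x := ⟨hdel.power_left.1.1, by rw [dist_comm]; exact h.dist_v⟩
  have hswap : ∀ q, orient w x q = -orient x w q := by
    intro q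
    unfold orient
    ring
  obtain ⟨t, ht, c, hor, hwc, htc, hempty⟩ : ∃ t ∈ nbhd V x, ∃ c, 0 < orient x w t * orient x w v ∧
      dist w c = dist x c ∧ dist t c = dist x c ∧ ∀ q ∈ nbhd V x, dist x c ≤ dist q c := by
    rcases lt_or_gt_of_ne (left_ne_zero_of_mul hsides.ne) with hv0 | hv0
    · obtain ⟨t, ht, c, h1, h2, h3, h4⟩ := exists_third_vertex (nbhd_finite V x) h.weakDel.symm hv
        (by rw [hswap]; linarith)
      rw [hswap] at h1
      exact ⟨t, ht, c, mul_pos_of_neg_of_neg (by linarith) hv0, h2.symm, h3.trans h2.symm,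
        fun q hq => h2 ▸ h4 q hq⟩
    · obtain ⟨t, ht, c, h1, h2, h3, h4⟩ := exists_third_vertex (nbhd_finite V x) h.weakDel hv hv0
      exact ⟨t, ht, c, mul_pos h1 hv0, h2, h3, h4⟩
  rcases hk.obstructs_step hV h ht hor hwc htc hempty with h1 | ⟨q, h1⟩
  · exact Or.inl ⟨t, h1, hor⟩
  · exact Or.inr ⟨t, q, h1⟩

theorem Kept.not_obstructs {V : Finset Plane} (hV : GeneralPosition V) {v y x w : Plane}
    (hk : Kept V v y) : ¬ Obstructs V v y x w := by
  intro h
  have hvy := hk.delaunayEdge.1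
  -- Choose `x` nearest to the line `vy`, then `w` such that `xw` crosses `vy` nearest to `v`; the
  -- quotient minimized is the parameter of that crossing.
  obtain ⟨x, ⟨-, w₀, hw₀⟩, hminx⟩ := Set.exists_min_image
    {x | x ∈ (V : Set Plane) ∧ ∃ w, Obstructs V v y x w} (fun x => |orient v y x|)
    (V.finite_toSet.subset (Set.sep_subset _ _)) ⟨x, h.left_mem, w, h⟩
  obtain ⟨w, ⟨-, hw⟩, hminw⟩ := Set.exists_min_image
    {w | w ∈ (V : Set Plane) ∧ Obstructs V v y x w}
    (fun w => orient x w v / (orient x w v - orient x w y))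
    (V.finite_toSet.subset (Set.sep_subset _ _)) ⟨w₀, hw₀.right_mem, hw₀⟩
  have hpar : ∀ w, Obstructs V v y x w → ∃ u s, 0 < u ∧ pt v y s = pt x w u ∧
      s = orient x w v / (orient x w v - orient x w y) ∧ orient x w v * orient x w y < 0 := by
    intro w hw
    obtain ⟨hn, s, u, -, -, hu0, -, hsu⟩ := (cross_iff hvy).1 hw.cross
    have hne : x ≠ w := by
      rintro rfl
      nlinarith [mul_self_nonneg (orient v y x)]
    have hsides := ((cross_iff hne).1 hw.cross.swap).1
    refine ⟨u, s, hu0, hsu, ?_, hsides⟩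
    have h0 := orient_self_pt x w u
    rw [← hsu, orient_pt] at h0
    have hd : orient x w v - orient x w y ≠ 0 := by
      intro h
      rw [sub_eq_zero.1 h] at hsides
      nlinarith [mul_self_nonneg (orient x w y)]
    rw [eq_div_iff hd]
    linarith
  rcases hk.exists_obstructs_step hV hw with ⟨t, ht, hor⟩ | ⟨t, q, htq, hlt⟩
  · have hle := hminw t ⟨ht.right_mem, ht⟩
    obtain ⟨u, s, hu, hsu, hs, hsides⟩ := hpar w hw
    obtain ⟨u', s', hu', hsu', hs', -⟩ := hpar t ht
    rw [← hs, ← hs'] at hle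
    have h1 : orient x w (pt v y s') = u' * orient x w t := by
      rw [hsu', orient_pt]
      unfold orient
      ring
    have h2 := orient_self_pt x w u
    rw [← hsu, orient_pt] at h2
    rw [orient_pt] at h1
    have h3 : 0 < u' * (orient x w t * orient x w v) := mul_pos hu' hor
    -- The factor after `s' - s` is negative and the right side positive, so `xt` would cross nearer
    -- to `v`.
    have h4 : (s' - s) * (orient x w y * orient x w v - orient x w v ^ 2) =
        u' * (orient x w t * orient x w v) := by
      linear_combination orient x w v * h1 - orient x w v * h2
    nlinarith [sq_nonneg (orient x w v)]
  · exact absurd (hminx t ⟨htq.left_mem, q, htq⟩) (not_le.2 hlt)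

/-! ### Two surviving edges do not cross -/

theorem Kept.weakDel_left {V : Finset Plane} {v y : Plane} (hk : Kept V v y) :
    WeakDel (nbhd V v) v y := by
  obtain ⟨hvy, o, r, hdel⟩ := hk.delaunayEdge
  have h0 := hdel.radius_nonneg
  have hv : v ∈ nbhd V v ∩ Metric.sphere o r := by rw [hdel.1]; simp
  have hy : y ∈ nbhd V v ∩ Metric.sphere o r := by rw [hdel.1]; simp
  refine ⟨o, (Metric.mem_sphere.1 hy.2).trans (Metric.mem_sphere.1 hv.2).symm, fun q hq => ?_⟩
  rw [Metric.mem_sphere.1 hv.2]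
  by_contra hn
  have : q ∈ nbhd V v ∩ Metric.ball o r := ⟨hq, not_le.1 hn⟩
  rw [hdel.2] at this
  exact this

/-- Of two crossing segments of length at most one, one has an endpoint that sees both endpoints of
the other one. -/
theorem Cross.exists_hub {v y a b : Plane} (h : Cross v y a b) (hvy : dist v y ≤ 1)
    (hab : dist a b ≤ 1) :
    (dist a v ≤ 1 ∧ dist a y ≤ 1) ∨ (dist b v ≤ 1 ∧ dist b y ≤ 1) ∨
      (dist v a ≤ 1 ∧ dist v b ≤ 1) ∨ (dist y a ≤ 1 ∧ dist y b ≤ 1) := by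
  obtain ⟨p, hp, hq⟩ := h.2
  have h1 := dist_add_dist_of_mem_segment (openSegment_subset_segment ℝ _ _ hp)
  have h2 := dist_add_dist_of_mem_segment (openSegment_subset_segment ℝ _ _ hq)
  have h3 := dist_triangle v p a
  have h4 := dist_triangle y p b
  have h5 := dist_triangle v p b
  have h6 := dist_triangle y p a
  rw [dist_comm p a] at h3 h6
  rw [dist_comm y p] at h4 h6
  rw [dist_comm a v, dist_comm a y, dist_comm b v, dist_comm b y]
  have h7 : dist v a ≤ 1 ∨ dist y b ≤ 1 := by
    by_contra hn
    push Not at hn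
    linarith
  have h8 : dist v b ≤ 1 ∨ dist y a ≤ 1 := by
    by_contra hn
    push Not at hn
    linarith
  tauto

/-- The hub may be either end of either edge. Being Delaunay as seen from both ends lets the hub's
own edge obstruct the other in all four cases. -/
theorem Kept.not_cross {V : Finset Plane} (hV : GeneralPosition V) {v y a b : Plane}
    (h₁ : Kept V v y) (h₂ : Kept V a b) : ¬ Cross v y a b := by
  intro hc
  obtain ⟨-, o, r, hdel⟩ := h₁.delaunayEdge
  obtain ⟨-, o', r', hdel'⟩ := h₂.delaunayEdge
  have hv := hdel.power_left.1
  have hy := hdel.power_right.1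
  have ha := hdel'.power_left.1
  have hb := hdel'.power_right.1
  have hvy : dist v y ≤ 1 := by rw [dist_comm]; exact hy.2
  have hab : dist a b ≤ 1 := by rw [dist_comm]; exact hb.2
  rcases hc.exists_hub hvy hab with h | h | h | h
  · exact h₁.not_obstructs hV ⟨ha.1, hb.1, h.1, h.2, hb.2, hc, h₂.weakDel_left⟩
  · exact h₁.not_obstructs hV ⟨hb.1, ha.1, h.1, h.2, hab, hc.symm_right, h₂.weakDel_right hV⟩
  · exact h₂.not_obstructs hV ⟨hv.1, hy.1, h.1, h.2, hy.2, hc.swap, h₁.weakDel_left⟩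
  · exact h₂.not_obstructs hV
      ⟨hy.1, hv.1, h.1, h.2, hvy, hc.swap.symm_right, h₁.weakDel_right hV⟩

end PLDG

theorem lemma5 (V : Finset Plane) (hV : PLDG.GeneralPosition V)
    (G : SimpleGraph {v : Plane // v ∈ V}) (hG : PLDG.IsPLDG V G) :
    PLDG.IsPlane G := by
  obtain ⟨E, hE, hadj⟩ := hG
  have key : ∀ a b, G.Adj a b → PLDG.Kept V a.1 b.1 ∨ PLDG.Kept V b.1 a.1 := fun a b h =>
    ((hadj a b).1 h).imp (fun h => ⟨E a, hE a, h⟩) (fun h => ⟨E b, hE b, h⟩)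
  intro a b c d hab hcd hc
  rcases key a b hab with h₁ | h₁ <;> rcases key c d hcd with h₂ | h₂
  · exact h₁.not_cross hV h₂ hc
  · exact h₁.not_cross hV h₂ hc.symm_right
  · exact h₁.not_cross hV h₂ hc.symm_left
  · exact h₁.not_cross hV h₂ hc.symm_left.symm_right
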